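/- A monotone triangle with $n$ rows is an array of integers $(a_{i,j})_{1\le i\le j\le n}$ with $a_{i,j}\le a_{i+1,j+1}$ for $1\le i\le j<n$, $a_{i,j}\le a_{i-1,j}$ for $1<i\le j\le n$, and $a_{i,j}<a_{i,j+1}$ for $1\le i\le j<n$; its bottom row is $(a_{1,1},\dots,a_{1,n})$. Its $Q$-weight is $Q$ raised to the number of entries $a_{i,j}$ with $i\neq 1$ and $a_{i-1,j-1}<a_{i,j}<a_{i-1,j}$. An $n\times n$ alternating sign matrix (ASM) is an $n\times n$ matrix with entries in $\{0,1,-1\}$ in which all row and column sums are $1$ and the nonzero entries of each row and of each column alternate in sign; its $Q$-weight is $Q$ raised to the number of its entries $-1$. An ASM is vertically symmetric if it is invariant under reflection in its vertical axis; such a matrix of odd size is weighted by $Q$ raised to the number of its entries $-1$ strictly to the left of the middle column (equivalently, the number of orbits of entries $-1$ under the reflection, not counting the entries in the middle column, which are forced by the symmetry). The $2$-enumeration of a finite set of such objects is the sum of the weights at $Q=2$. 1. For all integers $k_1<k_2<\dots<k_n$ there are finitely many monotone triangles with bottom row $(k_1,\dots,k_n)$, and their $2$-enumeration is $$2^{\binom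 n2}\prod_{1\le i<j\le n}\frac{k_j-k_i}{j-i}.$$ 2. The $2$-enumeration of $n\times n$ ASMs is $2^{\binom n2}$. 3. For $1\le l\le n$, the $2$-enumeration of the $n\times n$ ASMs whose unique $1$ in the first row is in column $l$ is $2^{\binom{n-1}2}\binom{n-1}{l-1}$. 4. For $n\ge 1$, the $2$-enumeration of $(2n-1)\times(2n-1)$ vertically symmetric ASMs is $2^{(n-1)(n-2)}$. -/

import Mathlib

/-- `a` is a monotone triangle with `n` rows: the entries are `a i j` for `1 ≤ i ≤ j ≤ n`,
where row `i = 1` is the bottom row and row `i = n` is the top row.  The values of `a` outside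
the triangle carry no information and are normalized to `0`. -/
structure IsMonotoneTriangle (n : ℕ) (a : ℕ → ℕ → ℤ) : Prop where
  northeast : ∀ i j : ℕ, 1 ≤ i → i ≤ j → j < n → a i j ≤ a (i + 1) (j + 1)
  southeast : ∀ i j : ℕ, 1 < i → i ≤ j → j ≤ n → a i j ≤ a (i - 1) j
  row_strict : ∀ i j : ℕ, 1 ≤ i → i ≤ j → j < n → a i j < a i (j + 1)
  outside : ∀ i j : ℕ, ¬ (1 ≤ i ∧ i ≤ j ∧ j ≤ n) → a i j = 0

/-- The monotone triangles with bottom row `(k 0, …, k (n - 1))`. -/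
def monotoneTriangles (n : ℕ) (k : Fin n → ℤ) : Set (ℕ → ℕ → ℤ) :=
  {a | IsMonotoneTriangle n a ∧ ∀ j : Fin n, a 1 ((j : ℕ) + 1) = k j}

/-- The number of entries `a i j` that are not in the bottom row and lie strictly between their
two neighbours in the row below. -/
def strictEntryCount (n : ℕ) (a : ℕ → ℕ → ℤ) : ℕ :=
  ((Finset.Icc 1 n ×ˢ Finset.Icc 1 n).filter (fun p : ℕ × ℕ =>
    1 < p.1 ∧ p.1 ≤ p.2 ∧
      a (p.1 - 1) (p.2 - 1) < a p.1 p.2 ∧ a p.1 p.2 < a (p.1 - 1) p.2)).card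

/-- The `Q`-enumeration of the monotone triangles with bottom row `k`. -/
noncomputable def monotoneTriangleEnum {R : Type*} [CommSemiring R] (Q : R) (n : ℕ)
    (k : Fin n → ℤ) : R :=
  ∑ᶠ a ∈ monotoneTriangles n k, Q ^ strictEntryCount n a

/-- The nonzero terms of the finite sequence `v` alternate in sign (for entries `0, 1, -1`). -/
def AlternatesInSign {n : ℕ} (v : Fin n → ℤ) : Prop :=
  ∀ i j : Fin n, i < j → v i ≠ 0 → v j ≠ 0 → (∀ m : Fin n, i < m → m < j → v m = 0) →
    v j = -v i

/-- Alternating sign matrices of size `n × n`. -/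
structure IsASM {n : ℕ} (A : Matrix (Fin n) (Fin n) ℤ) : Prop where
  entries : ∀ i j, A i j = 0 ∨ A i j = 1 ∨ A i j = -1
  row_sum : ∀ i, ∑ j, A i j = 1
  col_sum : ∀ j, ∑ i, A i j = 1
  row_alt : ∀ i, AlternatesInSign (fun j => A i j)
  col_alt : ∀ j, AlternatesInSign (fun i => A i j)

/-- The number of entries `-1` of `A`. -/
def negOneCount {n : ℕ} (A : Matrix (Fin n) (Fin n) ℤ) : ℕ :=
  (Finset.univ.filter (fun p : Fin n × Fin n => A p.1 p.2 = -1)).card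

/-- The `Q`-enumeration of a set of matrices with respect to the number of entries `-1`. -/
noncomputable def negOneEnum {R : Type*} [CommSemiring R] (Q : R) {n : ℕ}
    (S : Set (Matrix (Fin n) (Fin n) ℤ)) : R :=
  ∑ᶠ A ∈ S, Q ^ negOneCount A

/-- Vertically symmetric alternating sign matrices: invariant under reflection in the vertical
axis. -/
structure IsVSASM {n : ℕ} (A : Matrix (Fin n) (Fin n) ℤ) : Prop where
  isASM : IsASM A
  symm : ∀ i j, A i j.rev = A i j

/-- The number of entries `-1` of `A` strictly to the left of the vertical symmetry axis.  For a
vertically symmetric matrix this is the number of reflection orbits of entries `-1`, where the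
entries on the axis, which are forced by the symmetry, are not counted. -/
def leftNegOneCount {n : ℕ} (A : Matrix (Fin n) (Fin n) ℤ) : ℕ :=
  (Finset.univ.filter (fun p : Fin n × Fin n => p.2 < p.2.rev ∧ A p.1 p.2 = -1)).card

/-- The `Q`-enumeration of the vertically symmetric alternating sign matrices of size `n × n`. -/
noncomputable def vsasmEnum {R : Type*} [CommSemiring R] (Q : R) (n : ℕ) : R :=
  ∑ᶠ A ∈ {A : Matrix (Fin n) (Fin n) ℤ | IsVSASM A}, Q ^ leftNegOneCount A

/-! All four enumerations obey one recursion. Stripping the bottom row `k` of a monotone triangle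
leaves a triangle whose bottom row `l` interlaces `k`, and the row `l` contributes a factor 2 for
each entry strictly between its neighbours in `k`. So it suffices that the product formula satisfies
this recursion (`sum_interlacing_triangleFormula`).

Up to constants the formula is a Vandermonde determinant in `l`, which vanishes when two entries
coincide, so the sum over `l` may run over the whole box of intervals [k_i, k_{i+1}]. With the
determinant written in falling factorials, the sum acts on each row separately. The weights are 2
inside an interval and 1 at its ends, so each entry is a trapezoidal sum, and it telescopes to
F_j(k_{i+1}) - F_j(k_i) with F_j a polynomial of degree j + 1. A determinant of row differences is a
determinant with one more row and a first column of ones, here again a Vandermonde determinant, now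
in `k`.

For matrices, take the first m rows of an ASM: their column sums are 0 or 1, and the columns of sum
1 form an increasing sequence `k`. Stripping the last row replaces `k` by an interlacing `l`; that
row is the indicator of `k` minus that of `l`, and its entries -1 sit at the entries of `l` that are
not in `k`, which are the strict ones. The recursion is the same, so `partialASM_finite_and_enum`
gives the same formula. Full ASMs are the case `k` = (0, …, n - 1). Fixing the 1 of a boundary row
omits one value from this sequence. The left half of a vertically symmetric ASM, read by columns, is
the case `k` = (1, 3, …, 2m - 1). -/

/-! ### Falling factorials, trapezoidal sums and row differences -/

open Polynomial in
/-- A monic polynomial of degree `j` whose differences are the trapezoidal means of the falling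
factorials. -/
noncomputable def meanDescPochhammer (j : ℕ) : ℚ[X] :=
  C (1 / 2) * (descPochhammer ℚ j + (descPochhammer ℚ j).comp (X + C 1))

open Polynomial in
theorem meanDescPochhammer_monic_natDegree (j : ℕ) :
    (meanDescPochhammer j).Monic ∧ (meanDescPochhammer j).natDegree = j := by
  have h1 := monic_descPochhammer ℚ j
  have h2 : ((descPochhammer ℚ j).comp (X + C 1)).Monic := h1.comp_X_add_C 1
  have d1 := descPochhammer_natDegree ℚ j
  have d2 : ((descPochhammer ℚ j).comp (X + C 1)).natDegree = j := by
    rw [natDegree_comp, natDegree_X_add_C, d1, mul_one]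
  have hle : (meanDescPochhammer j).natDegree ≤ j := by
    refine (natDegree_C_mul_le _ _).trans ((natDegree_add_le _ _).trans ?_)
    rw [d1, d2, max_self]
  have hc : (meanDescPochhammer j).coeff j = 1 := by
    have c1 : (descPochhammer ℚ j).coeff j = 1 := by
      have := h1.coeff_natDegree
      rwa [d1] at this
    have c2 : ((descPochhammer ℚ j).comp (X + C 1)).coeff j = 1 := by
      have := h2.coeff_natDegree
      rwa [d2] at this
    rw [meanDescPochhammer, coeff_C_mul, coeff_add, c1, c2]
    norm_num
  exact ⟨monic_of_natDegree_le_of_coeff_eq_one j hle hc,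
    le_antisymm hle (le_natDegree_of_ne_zero (by rw [hc]; exact one_ne_zero))⟩

open Polynomial in
theorem descPochhammer_eval_add_one_sub (j : ℕ) (x : ℚ) :
    (descPochhammer ℚ (j + 1)).eval (x + 1) - (descPochhammer ℚ (j + 1)).eval x =
      (j + 1) * (descPochhammer ℚ j).eval x := by
  have h : (descPochhammer ℚ (j + 1)).eval (x + 1) = (x + 1) * (descPochhammer ℚ j).eval x := by
    rw [descPochhammer_succ_left]
    simp [eval_comp]
  rw [h, descPochhammer_succ_eval]
  ring

-- Provides the antiderivative for trapezoidal sums of falling factorials. The factors 2 / (j + 1)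
-- are what later multiply to 2 ^ n / n!, the remaining polynomial being monic.
open Polynomial in
theorem meanDescPochhammer_eval_add_one_sub (j : ℕ) (x : ℚ) :
    2 / (j + 1) * (meanDescPochhammer (j + 1)).eval (x + 1) -
        2 / (j + 1) * (meanDescPochhammer (j + 1)).eval x =
      (descPochhammer ℚ j).eval x + (descPochhammer ℚ j).eval (x + 1) := by
  have hj : (j : ℚ) + 1 ≠ 0 := by positivity
  have h1 := descPochhammer_eval_add_one_sub j x
  have h2 := descPochhammer_eval_add_one_sub j (x + 1)
  simp only [meanDescPochhammer, eval_mul, eval_C, eval_add, eval_comp, eval_X]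
  field_simp
  linear_combination h1 + h2

/-- A trapezoidal sum telescopes. -/
theorem sum_Icc_trapezoid {f F : ℤ → ℚ} (h : ∀ x, F (x + 1) - F x = f x + f (x + 1))
    {a b : ℤ} (hab : a < b) :
    ∑ x ∈ Finset.Icc a b, (if a < x ∧ x < b then 2 else 1) * f x = F b - F a := by
  -- Weight 2 inside and 1 at the ends is the sum over [a, b) plus the sum over (a, b]. The two
  -- descriptions disagree for a = b, where the single point has weight 1; hence the strict
  -- inequality.
  have key : ∀ b, a ≤ b →
      ∑ x ∈ Finset.Ico a b, f x + ∑ x ∈ Finset.Ioc a b, f x = F b - F a := by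
    intro b hb
    induction b, hb using Int.leInduction with
    | base => simp
    | succ b hb ih =>
      have e1 : Finset.Ico a (b + 1) = insert b (Finset.Ico a b) := by
        ext; simp only [Finset.mem_Ico, Finset.mem_insert]; omega
      have e2 : Finset.Ioc a (b + 1) = insert (b + 1) (Finset.Ioc a b) := by
        ext; simp only [Finset.mem_Ioc, Finset.mem_insert]; omega
      rw [e1, e2, Finset.sum_insert (by simp), Finset.sum_insert (by simp)]
      linear_combination ih - h b
  rw [← key b hab.le]
  have e1 : Finset.Ico a b = (Finset.Icc a b).filter (fun x => x < b) := by
    ext; simp only [Finset.mem_Ico, Finset.mem_filter, Finset.mem_Icc]; omega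
  have e2 : Finset.Ioc a b = (Finset.Icc a b).filter (fun x => a < x) := by
    ext; simp only [Finset.mem_Ioc, Finset.mem_filter, Finset.mem_Icc]; omega
  rw [e1, e2, Finset.sum_filter, Finset.sum_filter, ← Finset.sum_add_distrib]
  refine Finset.sum_congr rfl fun x hx => ?_
  rw [Finset.mem_Icc] at hx
  by_cases h1 : a < x <;> by_cases h2 : x < b
  · simp [h1, h2, two_mul]
  · simp [h1, h2]
  · simp [h1, h2]
  · omega

/-- If the first column is constant `1`, the determinant is that of the row differences. -/
theorem Matrix.det_eq_det_row_differences {n : ℕ} (M : Matrix (Fin (n + 1)) (Fin (n + 1)) ℚ)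
    (hM : ∀ i, M i 0 = 1) :
    M.det = (Matrix.of fun i j : Fin n => M i.succ j.succ - M i.castSucc j.succ).det := by
  let B : Matrix (Fin (n + 1)) (Fin (n + 1)) ℚ :=
    Matrix.of (Fin.cons (M 0) fun i j => M i.succ j - M i.castSucc j)
  have hB : M.det = B.det :=
    Matrix.det_eq_of_forall_row_eq_smul_add_pred (fun _ => 1) (fun j => by simp [B])
      (fun i j => by simp [B])
  -- After the row operations the first column is (1, 0, …, 0).
  rw [hB, Matrix.det_succ_column_zero, Fin.sum_univ_succ, Finset.sum_eq_zero]
  · simp only [B, Matrix.of_apply, Fin.cons_zero, hM, Fin.val_zero, pow_zero, one_mul, add_zero]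
    congr 1
  · intro i _
    simp [B, hM]

/-! ### The interlacing recursion for Vandermonde products -/

/-- The strictly increasing sequences interlacing `k`. -/
noncomputable def interlacing {n : ℕ} (k : Fin (n + 1) → ℤ) : Finset (Fin n → ℤ) :=
  open Classical in
  (Fintype.piFinset fun i : Fin n => Finset.Icc (k i.castSucc) (k i.succ)).filter StrictMono

theorem mem_interlacing {n : ℕ} {k : Fin (n + 1) → ℤ} {l : Fin n → ℤ} :
    l ∈ interlacing k ↔ (∀ i, k i.castSucc ≤ l i ∧ l i ≤ k i.succ) ∧ StrictMono l := by
  simp [interlacing, Fintype.mem_piFinset]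

/-- The number of entries of `l` strictly between their neighbours in `k`. -/
def strictCount {n : ℕ} (k : Fin (n + 1) → ℤ) (l : Fin n → ℤ) : ℕ :=
  (Finset.univ.filter fun i : Fin n => k i.castSucc < l i ∧ l i < k i.succ).card

/-- The Vandermonde product of an integer sequence. -/
def vandermondeProd {n : ℕ} (k : Fin n → ℤ) : ℚ :=
  ∏ i : Fin n, ∏ j ∈ Finset.Ioi i, ((k j : ℚ) - (k i : ℚ))

theorem vandermondeProd_eq_det {n : ℕ} (k : Fin n → ℤ) :
    vandermondeProd k = (Matrix.vandermonde fun i => (k i : ℚ)).det :=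
  (Matrix.det_vandermonde _).symm

theorem vandermondeProd_eq_zero_of_not_injective {n : ℕ} {k : Fin n → ℤ}
    (hk : ¬ Function.Injective k) : vandermondeProd k = 0 := by
  rw [vandermondeProd_eq_det, Matrix.det_vandermonde_eq_zero_iff]
  simp only [Function.Injective, not_forall] at hk
  obtain ⟨i, j, h, hij⟩ := hk
  exact ⟨i, j, by rw [h], hij⟩

/-- The heart of the argument: multilinearity in the rows moves the sum inside the determinant,
where each entry telescopes. -/
theorem sum_interlacing_vandermondeProd {n : ℕ} {k : Fin (n + 1) → ℤ} (hk : StrictMono k) :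
    ∑ l ∈ interlacing k, 2 ^ strictCount k l * vandermondeProd l =
      2 ^ n / n.factorial * vandermondeProd k := by
  classical
  let q : ℕ → Polynomial ℚ := descPochhammer ℚ
  let w : Fin n → ℤ → ℚ := fun i x => if k i.castSucc < x ∧ x < k i.succ then 2 else 1
  -- Every point of the box is weakly increasing, so a point that is not strictly increasing repeats
  -- a value and has Vandermonde product 0.
  have hbox : ∑ l ∈ interlacing k, 2 ^ strictCount k l * vandermondeProd l =
      ∑ l ∈ Fintype.piFinset fun i : Fin n => Finset.Icc (k i.castSucc) (k i.succ),
        2 ^ strictCount k l * vandermondeProd l := by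
    rw [interlacing]
    refine Finset.sum_filter_of_ne fun l hl hne => ?_
    by_contra hs
    refine hne ?_
    rw [vandermondeProd_eq_zero_of_not_injective, mul_zero]
    intro hinj
    refine hs (Monotone.strictMono_of_injective ?_ hinj)
    have hl' := fun i => Finset.mem_Icc.1 (Fintype.mem_piFinset.1 hl i)
    intro i j hij
    rcases hij.eq_or_lt with rfl | hij
    · exact le_rfl
    · exact (hl' i).2.trans ((hk.monotone (by simpa [Fin.le_def] using hij)).trans (hl' j).1)
  have hterm : ∀ l : Fin n → ℤ, 2 ^ strictCount k l * vandermondeProd l =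
      Matrix.detRowAlternating (fun i => (fun j : Fin n => w i (l i) * (q j).eval (l i : ℚ))) := by
    intro l
    have h1 : (2 : ℚ) ^ strictCount k l = ∏ i, w i (l i) := by
      simp [w, strictCount, Finset.prod_ite]
    rw [h1, vandermondeProd_eq_det,
      Matrix.det_eval_matrixOfPolynomials_eq_det_vandermonde _ (fun j : Fin n => q j)
      (fun j => descPochhammer_natDegree ℚ j) (fun j => monic_descPochhammer ℚ j)]
    exact (Matrix.det_mul_column _ _).symm
  have hsum : ∑ l ∈ Fintype.piFinset fun i : Fin n => Finset.Icc (k i.castSucc) (k i.succ),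
        2 ^ strictCount k l * vandermondeProd l =
      Matrix.det (Matrix.of fun i j : Fin n =>
        ∑ x ∈ Finset.Icc (k i.castSucc) (k i.succ), w i x * (q j).eval (x : ℚ)) := by
    have := MultilinearMap.map_sum_finset
      (Matrix.detRowAlternating (n := Fin n) (R := ℚ)).toMultilinearMap
      (fun i (x : ℤ) => (fun j : Fin n => w i x * (q j).eval (x : ℚ)))
      (fun i : Fin n => Finset.Icc (k i.castSucc) (k i.succ))
    rw [Finset.sum_congr rfl fun l _ => hterm l]
    refine this.symm.trans ?_
    change Matrix.det _ = _
    congr 1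
    ext i j
    simp [Finset.sum_apply]
  -- The same Vandermonde determinant in the basis of antiderivatives; its degree 0 member is the
  -- constant 1, which supplies the column of ones.
  have hM := Matrix.det_eval_matrixOfPolynomials_eq_det_vandermonde (fun i => (k i : ℚ))
    (fun j : Fin (n + 1) => meanDescPochhammer j)
    (fun j => (meanDescPochhammer_monic_natDegree j).2)
    (fun j => (meanDescPochhammer_monic_natDegree j).1)
  rw [Matrix.det_eq_det_row_differences (Matrix.of _)] at hM
  · rw [hbox, hsum, vandermondeProd_eq_det, hM]
    have hfac : (2 : ℚ) ^ n / n.factorial = ∏ j : Fin n, (2 / ((j : ℕ) + 1 : ℚ)) := by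
      rw [Finset.prod_div_distrib, Finset.prod_const, Finset.card_univ, Fintype.card_fin,
        ← Finset.prod_range_add_one_eq_factorial, ← Fin.prod_univ_eq_prod_range]
      push_cast
      rfl
    rw [hfac, ← Matrix.det_mul_row]
    congr 1
    ext i j
    have := sum_Icc_trapezoid (f := fun x : ℤ => (q j).eval (x : ℚ))
      (F := fun x : ℤ => 2 / ((j : ℕ) + 1 : ℚ) * (meanDescPochhammer (j + 1)).eval (x : ℚ))
      (fun x => by
        have := meanDescPochhammer_eval_add_one_sub j x
        push_cast
        exact this) (hk (Fin.castSucc_lt_succ (i := i)))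
    simp only [w, Matrix.of_apply, Fin.val_succ]
    rw [this]
    ring
  · intro i
    simp [meanDescPochhammer]
    norm_num

/-! ### The product formula and its special values -/

theorem prod_prod_Ioi_eq_prod_ite {n : ℕ} (f : Fin n → Fin n → ℚ) :
    ∏ i : Fin n, ∏ j ∈ Finset.Ioi i, f i j = ∏ i, ∏ j, if i < j then f i j else 1 := by
  refine Finset.prod_congr rfl fun i _ => ?_
  rw [← Finset.prod_filter]
  congr 1
  ext; simp

/-- Removing the entry `p` from `0, …, n`. -/
theorem vandermondeProd_succAbove {n : ℕ} (p : Fin (n + 1)) :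
    vandermondeProd (fun i : Fin (n + 1) => ((i : ℕ) : ℤ)) =
      (p : ℕ).factorial * (n - p : ℕ).factorial *
        vandermondeProd (fun i : Fin n => ((p.succAbove i : ℕ) : ℤ)) := by
  -- The factors involving `p` are the differences to the larger entries, with product (n - p)!, and
  -- those to the smaller entries, with product p!.
  have h1 : (∏ j : Fin n, if p < p.succAbove j then (((p.succAbove j : ℕ) : ℚ) - (p : ℕ)) else 1) =
      (n - p : ℕ).factorial := by
    have : (∏ j : Fin (n + 1), if p < j then (((j : ℕ) : ℚ) - (p : ℕ)) else 1) =
        (n - p : ℕ).factorial := by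
      simp only [Fin.lt_def]
      rw [Fin.prod_univ_eq_prod_range
        (fun j : ℕ => if (p : ℕ) < j then ((j : ℚ) - (p : ℕ)) else 1) (n + 1)]
      have hp := p.isLt
      generalize (p : ℕ) = r at hp ⊢
      have hn : n + 1 = (r + 1) + (n - r) := by omega
      rw [hn, Finset.prod_range_add, Finset.prod_eq_one, one_mul,
        ← Finset.prod_range_add_one_eq_factorial]
      · push_cast
        refine Finset.prod_congr rfl fun j _ => ?_
        rw [if_pos (by omega)]
        ring
      · intro j hj
        rw [if_neg (by simp at hj; omega)]
    rw [Fin.prod_univ_succAbove _ p] at this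
    simpa using this
  have h2 : (∏ j : Fin n, if p.succAbove j < p then (((p : ℕ) : ℚ) - (p.succAbove j : ℕ)) else 1) =
      (p : ℕ).factorial := by
    have : (∏ j : Fin (n + 1), if j < p then (((p : ℕ) : ℚ) - (j : ℕ)) else 1) =
        (p : ℕ).factorial := by
      simp only [Fin.lt_def]
      rw [Fin.prod_univ_eq_prod_range
        (fun j : ℕ => if j < (p : ℕ) then (((p : ℕ) : ℚ) - j) else 1) (n + 1)]
      have hp := p.isLt
      generalize (p : ℕ) = r at hp ⊢
      have hn : n + 1 = r + (n + 1 - r) := by omega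
      rw [hn, Finset.prod_range_add, mul_comm, Finset.prod_eq_one, one_mul,
        ← Finset.prod_range_add_one_eq_factorial, ← Finset.prod_range_reflect]
      · push_cast
        refine Finset.prod_congr rfl fun j hj => ?_
        rw [Finset.mem_range] at hj
        rw [if_pos (by omega), Nat.cast_sub (by omega), Nat.cast_sub (by omega)]
        push_cast
        ring
      · intro j hj
        rw [if_neg (by omega)]
    rw [Fin.prod_univ_succAbove _ p] at this
    simpa using this
  simp only [vandermondeProd, prod_prod_Ioi_eq_prod_ite]
  rw [Fin.prod_univ_succAbove _ p, Fin.prod_univ_succAbove _ p]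
  simp only [Fin.prod_univ_succAbove _ p, Finset.prod_mul_distrib, lt_irrefl, if_false, one_mul,
    Fin.succAbove_lt_succAbove_iff, Int.cast_natCast]
  rw [h1, h2]
  ring

theorem vandermondeProd_val_succ (n : ℕ) :
    vandermondeProd (fun i : Fin (n + 1) => ((i : ℕ) : ℤ)) =
      n.factorial * vandermondeProd (fun i : Fin n => ((i : ℕ) : ℤ)) := by
  simpa using vandermondeProd_succAbove (Fin.last n)

theorem vandermondeProd_val_ne_zero (n : ℕ) :
    vandermondeProd (fun i : Fin n => ((i : ℕ) : ℤ)) ≠ 0 := by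
  induction n with
  | zero => simp [vandermondeProd]
  | succ n ih =>
    rw [vandermondeProd_val_succ]
    exact mul_ne_zero (by positivity) ih

/-- The product formula for the `2`-enumeration. -/
def triangleFormula {n : ℕ} (k : Fin n → ℤ) : ℚ :=
  2 ^ n.choose 2 * (vandermondeProd k / vandermondeProd fun i : Fin n => ((i : ℕ) : ℤ))

theorem triangleFormula_eq_prod {n : ℕ} (k : Fin n → ℤ) :
    triangleFormula k = 2 ^ n.choose 2 *
      ∏ i : Fin n, ∏ j ∈ Finset.Ioi i,
        ((k j : ℚ) - (k i : ℚ)) / (((j : ℕ) : ℚ) - ((i : ℕ) : ℚ)) := by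
  simp [triangleFormula, vandermondeProd, Finset.prod_div_distrib]

/-- The constant 2 ^ n / n! is absorbed by the normalization: the exponent binom(n, 2) grows by n,
and the Vandermonde product of 0, …, n is n! times that of 0, …, n - 1. -/
theorem sum_interlacing_triangleFormula {n : ℕ} {k : Fin (n + 1) → ℤ} (hk : StrictMono k) :
    ∑ l ∈ interlacing k, 2 ^ strictCount k l * triangleFormula l = triangleFormula k := by
  have h := sum_interlacing_vandermondeProd hk
  have hn := vandermondeProd_val_ne_zero n
  have hf : (n.factorial : ℚ) ≠ 0 := by positivity
  have hc : (n + 1).choose 2 = n + n.choose 2 := by simp [Nat.choose_succ_succ' n 1]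
  simp only [triangleFormula, vandermondeProd_val_succ, hc, pow_add]
  have : ∀ l ∈ interlacing k, (2 : ℚ) ^ strictCount k l * (2 ^ n.choose 2 *
      (vandermondeProd l / vandermondeProd fun i : Fin n => ((i : ℕ) : ℤ))) =
      2 ^ n.choose 2 / (vandermondeProd fun i : Fin n => ((i : ℕ) : ℤ)) *
      (2 ^ strictCount k l * vandermondeProd l) := fun l _ => by ring
  rw [Finset.sum_congr rfl this, ← Finset.mul_sum, h]
  field_simp

theorem triangleFormula_val (n : ℕ) :
    triangleFormula (fun i : Fin n => ((i : ℕ) : ℤ)) = 2 ^ n.choose 2 := by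
  rw [triangleFormula, div_self (vandermondeProd_val_ne_zero n), mul_one]

theorem triangleFormula_succAbove {n : ℕ} (p : Fin (n + 1)) :
    triangleFormula (fun i : Fin n => ((p.succAbove i : ℕ) : ℤ)) =
      2 ^ n.choose 2 * n.choose p := by
  have h := vandermondeProd_succAbove p
  rw [vandermondeProd_val_succ] at h
  have hn := vandermondeProd_val_ne_zero n
  rw [triangleFormula, Nat.cast_choose ℚ (by omega : (p : ℕ) ≤ n)]
  congr 1
  rw [div_eq_div_iff hn (by positivity)]
  linear_combination -h

theorem sum_card_Ioi_fin (n : ℕ) : ∑ i : Fin n, (Finset.Ioi i).card = n.choose 2 := by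
  simp only [Fin.card_Ioi]
  rw [Fin.sum_univ_eq_sum_range (fun i => n - 1 - i) n, Finset.sum_range_reflect (fun i => i),
    Finset.sum_range_id, Nat.choose_two_right]

/-- Every quotient in the product is 2, so the product doubles the exponent binom(n, 2). -/
theorem triangleFormula_odd (n : ℕ) :
    triangleFormula (fun i : Fin n => (2 * (i : ℕ) + 1 : ℤ)) = 2 ^ (n * (n - 1)) := by
  have hprod : ∀ i : Fin n, ∀ j ∈ Finset.Ioi i,
      (((2 * (j : ℕ) + 1 : ℤ) : ℚ) - ((2 * (i : ℕ) + 1 : ℤ) : ℚ)) /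
        (((j : ℕ) : ℚ) - ((i : ℕ) : ℚ)) = 2 := by
    intro i j hij
    have : ((i : ℕ) : ℚ) < (j : ℕ) := by exact_mod_cast Finset.mem_Ioi.1 hij
    rw [div_eq_iff (by linarith)]
    push_cast
    ring
  rw [triangleFormula_eq_prod,
    Finset.prod_congr rfl fun i _ => Finset.prod_congr rfl fun j hj => hprod i j hj]
  simp only [Finset.prod_const]
  rw [Finset.prod_pow_eq_pow_sum, sum_card_Ioi_fin, ← pow_add, ← two_mul, Nat.choose_two_right,
    Nat.mul_div_cancel' (Nat.even_mul_pred_self n).two_dvd]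

/-! ### Monotone triangles by their bottom row -/

/-- Summation over a set that a projection maps bijectively onto a finite disjoint union. -/
theorem finsum_mem_eq_sum_of_bijOn_biUnion {α β ι : Type*} {S : Set β} {I : Finset ι}
    {T : ι → Set α} (π : β → α) (hT : ∀ l ∈ I, (T l).Finite)
    (hdisj : (I : Set ι).PairwiseDisjoint T) (hb : Set.BijOn π S (⋃ l ∈ (I : Set ι), T l))
    {f : β → ℚ} {g : α → ℚ} {c : ι → ℚ}
    (hw : ∀ l ∈ I, ∀ b ∈ S, π b ∈ T l → f b = c l * g (π b)) :
    S.Finite ∧ ∑ᶠ b ∈ S, f b = ∑ l ∈ I, c l * ∑ᶠ a ∈ T l, g a := by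
  classical
  have hU : (⋃ l ∈ (I : Set ι), T l).Finite := I.finite_toSet.biUnion hT
  refine ⟨hb.finite_iff_finite.2 hU, ?_⟩
  -- The inverse of `π` on `S` needs an inhabited type, so empty `S` is treated apart.
  rcases S.eq_empty_or_nonempty with rfl | hne
  · have h0 : ∀ l ∈ I, T l = ∅ := by
      intro l hl
      have := hb.image_eq
      rw [Set.image_empty] at this
      exact Set.subset_empty_iff.1 (this ▸ Set.subset_biUnion_of_mem (u := T) hl)
    rw [finsum_mem_empty, Finset.sum_eq_zero]
    intro l hl
    rw [h0 l hl, finsum_mem_empty, mul_zero]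
  have : Nonempty β := hne.to_subtype.map Subtype.val
  rw [finsum_mem_eq_of_bijOn (g := fun a => f (Function.invFunOn π S a)) π hb
    fun b hbS => by rw [hb.injOn.leftInvOn_invFunOn hbS],
    finsum_mem_biUnion hdisj I.finite_toSet hT, finsum_mem_coe_finset]
  refine Finset.sum_congr rfl fun l hl => ?_
  rw [mul_finsum_mem]
  refine finsum_mem_congr rfl fun a ha => ?_
  have haU : a ∈ π '' S := hb.image_eq ▸ Set.mem_biUnion (t := T) hl ha
  have h1 := Function.invFunOn_mem haU
  have h2 := Function.invFunOn_eq haU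
  have := hw l hl _ h1 (by rwa [h2])
  rwa [h2] at this

theorem strictMono_fin_of_lt_succ {n : ℕ} {l : Fin n → ℤ}
    (h : ∀ (j : ℕ) (hj : j + 1 < n), l ⟨j, by omega⟩ < l ⟨j + 1, hj⟩) : StrictMono l := by
  cases n with
  | zero => exact fun i => i.elim0
  | succ n => exact Fin.strictMono_iff_lt_succ.2 fun i => h i (by omega)

/-- Remove the bottom row of a triangle. -/
def dropBottomRow (a : ℕ → ℕ → ℤ) : ℕ → ℕ → ℤ :=
  fun i j => if 1 ≤ i then a (i + 1) (j + 1) else 0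

/-- Add a bottom row to a triangle. -/
def addBottomRow {n : ℕ} (k : Fin n → ℤ) (b : ℕ → ℕ → ℤ) : ℕ → ℕ → ℤ :=
  fun i j => if i = 1 then (if h : 1 ≤ j ∧ j ≤ n then k ⟨j - 1, by omega⟩ else 0)
    else if 2 ≤ i ∧ 1 ≤ j then b (i - 1) (j - 1) else 0

theorem dropBottomRow_mem {n : ℕ} {k : Fin (n + 1) → ℤ} {a : ℕ → ℕ → ℤ}
    (ha : a ∈ monotoneTriangles (n + 1) k) :
    (fun j : Fin n => a 2 (j + 2)) ∈ interlacing k ∧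
      dropBottomRow a ∈ monotoneTriangles n (fun j : Fin n => a 2 (j + 2)) := by
  obtain ⟨ha, hk⟩ := ha
  refine ⟨mem_interlacing.2 ⟨fun j => ⟨?_, ?_⟩, ?_⟩, ⟨?_, ?_, ?_, ?_⟩, ?_⟩
  · rw [← hk]
    exact ha.northeast 1 (j + 1) (by omega) (by omega) (by omega)
  · rw [← hk]
    exact ha.southeast 2 (j + 2) (by omega) (by omega) (by omega)
  · exact strictMono_fin_of_lt_succ fun j hj =>
      ha.row_strict 2 (j + 2) (by omega) (by omega) (by omega)
  · intro i j h1 h2 h3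
    simp only [dropBottomRow, h1, if_true, Nat.le_add_left]
    exact ha.northeast (i + 1) (j + 1) (by omega) (by omega) (by omega)
  · intro i j h1 h2 h3
    have := ha.southeast (i + 1) (j + 1) (by omega) (by omega) (by omega)
    simp only [dropBottomRow]
    rw [if_pos (by omega), if_pos (by omega), show i - 1 + 1 = i by omega]
    exact this
  · intro i j h1 h2 h3
    simp only [dropBottomRow, h1, if_true]
    exact ha.row_strict (i + 1) (j + 1) (by omega) (by omega) (by omega)
  · intro i j h
    simp only [dropBottomRow]
    split_ifs with h1
    · exact ha.outside _ _ (by omega)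
    · rfl
  · intro j
    simp [dropBottomRow, add_assoc]

theorem addBottomRow_mem {n : ℕ} {k : Fin (n + 1) → ℤ} (hk : StrictMono k) {l : Fin n → ℤ}
    (hl : l ∈ interlacing k) {b : ℕ → ℕ → ℤ} (hb : b ∈ monotoneTriangles n l) :
    addBottomRow k b ∈ monotoneTriangles (n + 1) k := by
  obtain ⟨hb, hbl⟩ := hb
  have hl := (mem_interlacing.1 hl).1
  have hbl' : ∀ j (hj : 1 ≤ j ∧ j ≤ n), b 1 j = l ⟨j - 1, by omega⟩ := by
    intro j hj
    rw [← hbl]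
    congr 1
    simp only
    omega
  refine ⟨⟨?_, ?_, ?_, ?_⟩, ?_⟩
  · intro i j h1 h2 h3
    by_cases hi : i = 1
    · subst hi
      simp only [addBottomRow, if_true]
      rw [dif_pos (by omega), if_neg (by omega), if_pos (by omega)]
      simp only [Nat.add_sub_cancel]
      rw [hbl' j (by omega)]
      exact (hl ⟨j - 1, by omega⟩).1
    · simp only [addBottomRow]
      rw [if_neg hi, if_pos (by omega), if_neg (by omega), if_pos (by omega)]
      have := hb.northeast (i - 1) (j - 1) (by omega) (by omega) (by omega)
      rwa [show i - 1 + 1 = i + 1 - 1 by omega, show j - 1 + 1 = j + 1 - 1 by omega] at this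
  · intro i j h1 h2 h3
    by_cases hi : i = 2
    · subst hi
      simp only [addBottomRow]
      rw [if_neg (by omega), if_pos (by omega), if_pos trivial, dif_pos (by omega),
        hbl' (j - 1) (by omega)]
      refine (hl ⟨j - 1 - 1, by omega⟩).2.trans (le_of_eq ?_)
      congr 1
      ext
      simp only [Fin.succ_mk]
      omega
    · simp only [addBottomRow]
      rw [if_neg (by omega), if_pos (by omega), if_neg (by omega), if_pos (by omega)]
      exact hb.southeast (i - 1) (j - 1) (by omega) (by omega) (by omega)
  · intro i j h1 h2 h3
    by_cases hi : i = 1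
    · subst hi
      simp only [addBottomRow, if_true]
      rw [dif_pos (by omega), dif_pos (by omega)]
      exact hk (by rw [Fin.lt_def]; simp only; omega)
    · simp only [addBottomRow]
      rw [if_neg hi, if_pos (by omega), if_neg (by omega), if_pos (by omega)]
      have := hb.row_strict (i - 1) (j - 1) (by omega) (by omega) (by omega)
      rwa [show j - 1 + 1 = j + 1 - 1 by omega] at this
  · intro i j h
    simp only [addBottomRow]
    split_ifs
    · omega
    · rfl
    · exact hb.outside _ _ (by omega)
    · rfl
  · intro j
    simp only [addBottomRow, if_true]
    rw [dif_pos (by omega)]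
    rfl

theorem dropBottomRow_addBottomRow {n : ℕ} (k : Fin (n + 1) → ℤ) {l : Fin n → ℤ}
    {b : ℕ → ℕ → ℤ} (hb : b ∈ monotoneTriangles n l) :
    dropBottomRow (addBottomRow k b) = b := by
  funext i j
  simp only [dropBottomRow, addBottomRow]
  split_ifs
  · omega
  · omega
  · simp
  · omega
  · exact (hb.1.outside _ _ (by omega)).symm

theorem dropBottomRow_injOn {n : ℕ} (k : Fin (n + 1) → ℤ) :
    Set.InjOn dropBottomRow (monotoneTriangles (n + 1) k) := by
  rintro a ⟨ha, hak⟩ b ⟨hb, hbk⟩ hab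
  funext i j
  by_cases hij : 1 ≤ i ∧ i ≤ j ∧ j ≤ n + 1
  · by_cases hi : i = 1
    · have h1 := hak ⟨j - 1, by omega⟩
      have h2 := hbk ⟨j - 1, by omega⟩
      simp only [show j - 1 + 1 = j by omega] at h1 h2
      rw [hi, h1, h2]
    · have := congrFun (congrFun hab (i - 1)) (j - 1)
      simp only [dropBottomRow] at this
      rwa [if_pos (by omega), if_pos (by omega), show i - 1 + 1 = i by omega,
        show j - 1 + 1 = j by omega] at this
  · rw [ha.outside i j hij, hb.outside i j hij]

theorem strictEntryCount_succ {n : ℕ} {k : Fin (n + 1) → ℤ} {a : ℕ → ℕ → ℤ}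
    (ha : a ∈ monotoneTriangles (n + 1) k) :
    strictEntryCount (n + 1) a =
      strictCount k (fun j : Fin n => a 2 (j + 2)) + strictEntryCount n (dropBottomRow a) := by
  obtain ⟨ha, hk⟩ := ha
  -- `e₁` lists the second row, whose strict entries are counted against `k`; `e₂` shifts the
  -- positions of the smaller triangle back into the larger one.
  let e₁ : Fin n → ℕ × ℕ := fun j => (2, j + 2)
  let e₂ : ℕ × ℕ → ℕ × ℕ := fun p => (p.1 + 1, p.2 + 1)
  have he₁ : Function.Injective e₁ := by
    intro i j h
    simp only [e₁, Prod.mk.injEq, true_and] at h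
    exact Fin.ext (by omega)
  have he₂ : Function.Injective e₂ := by
    rintro ⟨i, j⟩ ⟨i', j'⟩ h
    simp only [e₂, Prod.mk.injEq] at h ⊢
    omega
  have hc₁ := Finset.card_image_of_injective (Finset.univ.filter fun i : Fin n =>
    k i.castSucc < a 2 (i + 2) ∧ a 2 (i + 2) < k i.succ) he₁
  rw [strictCount, strictEntryCount.eq_1 n, ← hc₁, ← Finset.card_image_of_injective
    (Finset.filter _ (Finset.Icc 1 n ×ˢ Finset.Icc 1 n)) he₂, ← Finset.card_union_of_disjoint,
    strictEntryCount]
  · congr 1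
    ext ⟨i, j⟩
    simp only [Finset.mem_filter, Finset.mem_product, Finset.mem_Icc, Finset.mem_union,
      Finset.mem_image, Finset.mem_univ, true_and, e₁, e₂, Prod.mk.injEq, Prod.exists, ← hk]
    simp only [dropBottomRow]
    constructor
    · rintro ⟨⟨hi, hj⟩, h1, h2, h3, h4⟩
      by_cases h : i = 2
      · subst h
        refine Or.inl ⟨⟨j - 2, by omega⟩, ⟨?_, ?_⟩, rfl, ?_⟩
        · simpa [show j - 2 + 1 = j - 1 by omega, show j - 2 + 2 = j by omega] using h3
        · simpa [show j - 2 + 1 + 1 = j by omega, show j - 2 + 2 = j by omega] using h4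
        · simp only; omega
      · refine Or.inr ⟨i - 1, j - 1, ⟨⟨by omega, by omega⟩, by omega, by omega, ?_⟩, by omega,
          by omega⟩
        rw [if_pos (by omega), if_pos (by omega), if_pos (by omega),
          show i - 1 - 1 + 1 = i - 1 by omega, show j - 1 - 1 + 1 = j - 1 by omega,
          show i - 1 + 1 = i by omega, show j - 1 + 1 = j by omega]
        exact ⟨h3, h4⟩
    · rintro (⟨m, ⟨h1, h2⟩, rfl, rfl⟩ | ⟨i, j, ⟨⟨hi, hj⟩, h1, h2, h3⟩, rfl, rfl⟩)
      · have := m.isLt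
        exact ⟨by omega, by omega, by omega, h1, h2⟩
      · rw [if_pos (by omega), if_pos (by omega), if_pos (by omega),
          show i - 1 + 1 = i by omega, show j - 1 + 1 = j by omega] at h3
        exact ⟨by omega, by omega, by omega, h3⟩
  · rw [Finset.disjoint_left]
    intro p hp hq
    simp only [Finset.mem_image, Finset.mem_filter, e₁, e₂] at hp hq
    obtain ⟨m, -, rfl⟩ := hp
    obtain ⟨q, hq, h⟩ := hq
    simp only [Prod.mk.injEq] at h
    omega

theorem monotoneTriangles_zero (k : Fin 0 → ℤ) : monotoneTriangles 0 k = {fun _ _ => 0} := by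
  ext a
  simp only [Set.mem_singleton_iff]
  constructor
  · rintro ⟨ha, -⟩
    funext i j
    exact ha.outside i j (by omega)
  · rintro rfl
    exact ⟨⟨by intros; omega, by intros; omega, by intros; omega, by intros; rfl⟩,
      fun j => j.elim0⟩

/-- Induction on the number of rows: the triangles with bottom row `k` are fibred over the second
row `l`, on which the weight splits off 2 ^ `strictCount k l`. -/
theorem monotoneTriangles_finite_and_enum (n : ℕ) (k : Fin n → ℤ) (hk : StrictMono k) :
    (monotoneTriangles n k).Finite ∧ monotoneTriangleEnum (2 : ℚ) n k = triangleFormula k := by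
  induction n with
  | zero =>
    rw [monotoneTriangleEnum, monotoneTriangles_zero]
    refine ⟨Set.finite_singleton _, ?_⟩
    rw [finsum_mem_singleton]
    simp [strictEntryCount, triangleFormula, vandermondeProd]
  | succ n ih =>
    rw [← sum_interlacing_triangleFormula hk]
    have hmono : ∀ l ∈ interlacing k, StrictMono l := fun l hl => (mem_interlacing.1 hl).2
    have hrow : ∀ {a l}, a ∈ monotoneTriangles (n + 1) k →
        dropBottomRow a ∈ monotoneTriangles n l → (fun j : Fin n => a 2 (j + 2)) = l := by
      intro a l _ h
      funext j
      rw [← h.2 j]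
      simp [dropBottomRow, add_assoc]
    have := finsum_mem_eq_sum_of_bijOn_biUnion (S := monotoneTriangles (n + 1) k)
      (I := interlacing k) (T := monotoneTriangles n) dropBottomRow
      (fun l hl => (ih l (hmono l hl)).1)
      (fun l _ l' _ hne => Set.disjoint_left.2 fun a h h' => hne (by
        funext j
        rw [← h.2 j, ← h'.2 j]))
      ⟨fun a ha => Set.mem_biUnion (dropBottomRow_mem ha).1 (dropBottomRow_mem ha).2,
        dropBottomRow_injOn k, fun b hb => by
          simp only [Set.mem_iUnion] at hb
          obtain ⟨l, hl, hb⟩ := hb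
          exact ⟨_, addBottomRow_mem hk hl hb, dropBottomRow_addBottomRow k hb⟩⟩
      (f := fun a => 2 ^ strictEntryCount (n + 1) a) (g := fun a => 2 ^ strictEntryCount n a)
      (c := fun l => 2 ^ strictCount k l)
      (fun l _ a ha hl => by
        rw [strictEntryCount_succ ha, hrow ha hl, pow_add])
    refine ⟨this.1, this.2.trans (Finset.sum_congr rfl fun l hl => ?_)⟩
    rw [← (ih l (hmono l hl)).2]
    rfl

/-! ### Prefix sums and sign alternation -/

/-- The sum of the first `t` terms of a finite sequence. -/
def prefixSum {n : ℕ} (v : Fin n → ℤ) (t : ℕ) : ℤ :=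
  ∑ j ∈ Finset.range t, if h : j < n then v ⟨j, h⟩ else 0

theorem prefixSum_zero {n : ℕ} (v : Fin n → ℤ) : prefixSum v 0 = 0 := by
  simp [prefixSum]

theorem prefixSum_succ {n : ℕ} (v : Fin n → ℤ) {t : ℕ} (ht : t < n) :
    prefixSum v (t + 1) = prefixSum v t + v ⟨t, ht⟩ := by
  rw [prefixSum, Finset.sum_range_succ, dif_pos ht, prefixSum]

theorem prefixSum_succ_of_le {n : ℕ} (v : Fin n → ℤ) {t : ℕ} (ht : n ≤ t) :
    prefixSum v (t + 1) = prefixSum v t := by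
  rw [prefixSum, Finset.sum_range_succ, dif_neg (by omega), prefixSum, add_zero]

theorem prefixSum_of_le {n : ℕ} (v : Fin n → ℤ) {t : ℕ} (ht : n ≤ t) :
    prefixSum v t = ∑ j, v j := by
  induction t, ht using Nat.le_induction with
  | base => rw [prefixSum, Finset.sum_range]; simp
  | succ t ht ih => rw [prefixSum_succ_of_le v ht, ih]

theorem prefixSum_cons {n : ℕ} (v : Fin (n + 1) → ℤ) (t : ℕ) :
    prefixSum v (t + 1) = v 0 + prefixSum (fun j : Fin n => v j.succ) t := by
  induction t with
  | zero => rw [prefixSum_succ v (by omega), prefixSum_zero, prefixSum_zero]; simp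
  | succ t ih =>
    by_cases ht : t < n
    · rw [prefixSum_succ v (by omega : t + 1 < n + 1), ih, prefixSum_succ _ ht, add_assoc]
      rfl
    · rw [prefixSum_succ_of_le v (by omega), ih, prefixSum_succ_of_le _ (by omega)]

theorem prefixSum_castLE {m n : ℕ} (h : m ≤ n) (v : Fin n → ℤ) (t : ℕ) :
    prefixSum (fun i : Fin m => v (Fin.castLE h i)) t = prefixSum v (min t m) := by
  induction t with
  | zero => simp [prefixSum_zero]
  | succ t ih =>
    by_cases ht : t < m
    · rw [prefixSum_succ _ ht, ih, min_eq_left ht.le, min_eq_left (by omega : t + 1 ≤ m),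
        prefixSum_succ v (by omega)]
      rfl
    · rw [prefixSum_succ_of_le _ (by omega), ih, min_eq_right (by omega), min_eq_right (by omega)]

theorem prefixSum_rev {n : ℕ} (v : Fin n → ℤ) (t : ℕ) :
    prefixSum (fun i => v i.rev) t = ∑ j, v j - prefixSum v (n - t) := by
  induction t with
  | zero => rw [prefixSum_zero, prefixSum_of_le v (by omega), sub_self]
  | succ t ih =>
    by_cases ht : t < n
    · rw [prefixSum_succ _ ht, ih, show n - t = (n - (t + 1)) + 1 by omega,
        prefixSum_succ v (by omega : n - (t + 1) < n)]
      have : (⟨t, ht⟩ : Fin n).rev = ⟨n - (t + 1), by omega⟩ := rfl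
      rw [this]
      ring
    · rw [prefixSum_succ_of_le _ (by omega), ih, show n - (t + 1) = n - t by omega]

theorem prefixSum_sub {n : ℕ} (v w : Fin n → ℤ) (t : ℕ) :
    prefixSum (fun j => v j - w j) t = prefixSum v t - prefixSum w t := by
  rw [prefixSum, prefixSum, prefixSum, ← Finset.sum_sub_distrib]
  refine Finset.sum_congr rfl fun j _ => ?_
  split_ifs <;> simp

/-- All prefix sums are `0` or `1`, and the total is `1`. -/
structure HasUnitPrefixes {n : ℕ} (v : Fin n → ℤ) : Prop where
  prefixes : ∀ t, prefixSum v t = 0 ∨ prefixSum v t = 1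
  total : ∑ j, v j = 1

/-- The nonzero terms are x, -x, x, …, so the partial sums oscillate between x and 0, where x is the
first nonzero term. -/
theorem AlternatesInSign.prefixSum {n : ℕ} {v : Fin n → ℤ} (h : AlternatesInSign v) :
    (∀ i, v i = 0) ∨ ∃ i, v i ≠ 0 ∧ (∀ m < i, v m = 0) ∧
      ∀ t, prefixSum v t = 0 ∨ prefixSum v t = v i := by
  induction n with
  | zero => exact Or.inl fun i => i.elim0
  | succ n ih =>
    have htail : AlternatesInSign fun j : Fin n => v j.succ := by
      intro i j hij hi hj hm
      refine h i.succ j.succ (Fin.succ_lt_succ_iff.2 hij) hi hj fun m hm1 hm2 => ?_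
      obtain ⟨m, rfl⟩ := Fin.exists_succ_eq.2 (Fin.ne_zero_of_lt hm1)
      exact hm m (Fin.succ_lt_succ_iff.1 hm1) (Fin.succ_lt_succ_iff.1 hm2)
    by_cases h0 : v 0 = 0
    · rcases ih htail with hz | ⟨i, hi, hm, ht⟩
      · exact Or.inl fun i => Fin.cases h0 hz i
      · refine Or.inr ⟨i.succ, hi, fun m hmi => ?_, fun t => ?_⟩
        · induction m using Fin.cases with
          | zero => exact h0
          | succ m => exact hm m (Fin.succ_lt_succ_iff.1 hmi)
        · cases t with
          | zero => exact Or.inl (prefixSum_zero v)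
          | succ t =>
            rw [prefixSum_cons, h0, zero_add]
            exact ht t
    · refine Or.inr ⟨0, h0, fun m hm => absurd hm (Fin.not_lt_zero m), fun t => ?_⟩
      cases t with
      | zero => exact Or.inl (prefixSum_zero v)
      | succ t =>
        rw [prefixSum_cons]
        rcases ih htail with hz | ⟨i, hi, hm, ht⟩
        · right
          simp only [hz]
          simp [_root_.prefixSum]
        · have hneg := h 0 i.succ (Fin.succ_pos i) h0 hi fun m hm1 hm2 => by
            obtain ⟨m, rfl⟩ := Fin.exists_succ_eq.2 (Fin.ne_zero_of_lt hm1)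
            exact hm m (Fin.succ_lt_succ_iff.1 hm2)
          rcases ht t with ht | ht <;> rw [ht]
          · exact Or.inr (add_zero _)
          · left
            rw [hneg]
            ring

theorem HasUnitPrefixes.of_alternatesInSign {n : ℕ} {v : Fin n → ℤ} (h : AlternatesInSign v)
    (hs : ∑ j, v j = 1) : HasUnitPrefixes v := by
  refine ⟨?_, hs⟩
  rcases h.prefixSum with hz | ⟨i, hi, -, ht⟩
  · simp [hz] at hs
  · have := ht n
    rw [prefixSum_of_le v le_rfl, hs] at this
    rcases this with h1 | h1
    · omega
    · rwa [← h1] at ht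

theorem HasUnitPrefixes.entries {n : ℕ} {v : Fin n → ℤ} (h : HasUnitPrefixes v) (i : Fin n) :
    v i = 0 ∨ v i = 1 ∨ v i = -1 := by
  have := prefixSum_succ v i.isLt
  have h1 := h.prefixes i
  have h2 := h.prefixes (i + 1)
  simp only [Fin.eta] at this
  omega

theorem HasUnitPrefixes.alternatesInSign {n : ℕ} {v : Fin n → ℤ} (h : HasUnitPrefixes v) :
    AlternatesInSign v := by
  intro i j hij hi hj hm
  -- Between consecutive nonzero entries the prefix sum is constant; since it stays in {0, 1}, the
  -- step before and the step after must be opposite.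
  have hconst : ∀ t, (i : ℕ) + 1 ≤ t → t ≤ j → prefixSum v t = prefixSum v (i + 1) := by
    intro t ht
    induction t, ht using Nat.le_induction with
    | base => exact fun _ => rfl
    | succ t ht ih =>
      intro htj
      rw [prefixSum_succ v (by omega), hm ⟨t, by omega⟩ (Fin.lt_def.2 (by simp only; omega))
        (Fin.lt_def.2 (by simp only; omega)), add_zero, ih (by omega)]
  have h1 := prefixSum_succ v i.isLt
  have h2 := prefixSum_succ v j.isLt
  have h3 := hconst j (Fin.lt_def.1 hij) le_rfl
  have h4 := h.prefixes i
  have h5 := h.prefixes (i + 1)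
  have h6 := h.prefixes (j + 1)
  simp only [Fin.eta] at h1 h2
  omega

/-- Total 1 forces the first nonzero term to be 1, which turns alternation into the condition that
prefix sums lie in {0, 1}; this form can be compared with counting functions. -/
theorem isASM_iff {n : ℕ} {A : Matrix (Fin n) (Fin n) ℤ} :
    IsASM A ↔ (∀ i, HasUnitPrefixes (A i)) ∧ ∀ j, HasUnitPrefixes fun i => A i j :=
  ⟨fun h => ⟨fun i => .of_alternatesInSign (h.row_alt i) (h.row_sum i),
    fun j => .of_alternatesInSign (h.col_alt j) (h.col_sum j)⟩,
  fun h => ⟨fun i j => (h.1 i).entries j, fun i => (h.1 i).total, fun j => (h.2 j).total,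
    fun i => (h.1 i).alternatesInSign, fun j => (h.2 j).alternatesInSign⟩⟩

/-! ### Indicators and counting functions of increasing sequences -/

/-- The number of entries of `k` equal to `y`. -/
def valueCount {m : ℕ} (k : Fin m → ℤ) (y : ℤ) : ℤ := ∑ i, if k i = y then 1 else 0

/-- The number of entries of `k` below `x`. -/
def countBelow {m : ℕ} (k : Fin m → ℤ) (x : ℤ) : ℕ := (Finset.univ.filter fun i => k i < x).card

theorem valueCount_eq_one {m : ℕ} {k : Fin m → ℤ} (hk : StrictMono k) (i : Fin m) :
    valueCount k (k i) = 1 := by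
  simp [valueCount, hk.injective.eq_iff]

theorem valueCount_eq_zero {m : ℕ} {k : Fin m → ℤ} {y : ℤ} (h : ∀ i, k i ≠ y) :
    valueCount k y = 0 := by
  simp [valueCount, h]

theorem valueCount_eq_zero_or_one {m : ℕ} {k : Fin m → ℤ} (hk : StrictMono k) (y : ℤ) :
    valueCount k y = 0 ∨ valueCount k y = 1 := by
  by_cases h : ∃ i, k i = y
  · obtain ⟨i, rfl⟩ := h
    exact Or.inr (valueCount_eq_one hk i)
  · exact Or.inl (valueCount_eq_zero fun i hi => h ⟨i, hi⟩)

theorem prefixSum_valueCount {m N : ℕ} {k : Fin m → ℤ} (hk : ∀ i, 0 ≤ k i ∧ k i < N) (t : ℕ) :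
    prefixSum (fun c : Fin N => valueCount k ((c : ℕ) : ℤ)) t = countBelow k t := by
  induction t with
  | zero =>
    have : countBelow k ((0 : ℕ) : ℤ) = 0 := by
      simp only [countBelow, Finset.card_eq_zero, Finset.filter_eq_empty_iff]
      intro i _
      have := hk i
      omega
    rw [prefixSum_zero, this, Nat.cast_zero]
  | succ t ih =>
    have hstep : (countBelow k ((t + 1 : ℕ) : ℤ) : ℤ) = countBelow k t + valueCount k t := by
      simp only [countBelow, valueCount, Finset.card_filter, Nat.cast_sum,
        ← Finset.sum_add_distrib]
      refine Finset.sum_congr rfl fun i _ => ?_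
      split_ifs <;> omega
    by_cases ht : t < N
    · rw [prefixSum_succ _ ht, ih, hstep]
    · rw [prefixSum_succ_of_le _ (by omega), ih, hstep, valueCount_eq_zero, add_zero]
      intro i hi
      have := hk i
      omega

theorem countBelow_le {m : ℕ} {l : Fin m → ℤ} (hl : StrictMono l) {i : Fin m} {x : ℤ}
    (h : x ≤ l i) : countBelow l x ≤ i := by
  rw [← Fin.card_Iio i]
  refine Finset.card_le_card fun j hj => ?_
  rw [Finset.mem_filter] at hj
  exact Finset.mem_Iio.2 (hl.lt_iff_lt.1 (hj.2.trans_le h))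

theorem le_countBelow {m : ℕ} {l : Fin m → ℤ} (hl : StrictMono l) {i : Fin m} {x : ℤ}
    (h : l i < x) : i + 1 ≤ countBelow l x := by
  rw [← Fin.card_Iic i]
  refine Finset.card_le_card fun j hj => ?_
  exact Finset.mem_filter.2 ⟨Finset.mem_univ _, (hl.monotone (Finset.mem_Iic.1 hj)).trans_lt h⟩

theorem countBelow_eq_of_lt {m : ℕ} {k : Fin m → ℤ} {x : ℤ} (h : ∀ i, k i < x) :
    countBelow k x = m := by
  simp [countBelow, h]

/-- Below `x`, each l_i brings k_i with it, and each k_{i+1} brings l_i; only k_0 has no partner. -/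
theorem countBelow_of_interlacing {n : ℕ} {k : Fin (n + 1) → ℤ} {l : Fin n → ℤ}
    (h : ∀ i, k i.castSucc ≤ l i ∧ l i ≤ k i.succ) (x : ℤ) :
    (countBelow k x : ℤ) - countBelow l x = 0 ∨ (countBelow k x : ℤ) - countBelow l x = 1 := by
  have h1 : countBelow l x ≤ countBelow k x := by
    refine Finset.card_le_card_of_injOn Fin.castSucc (fun i hi => ?_)
      (Fin.castSucc_injective n).injOn
    simp only [Finset.coe_filter, Finset.mem_univ, true_and, Set.mem_ofPred_eq] at hi ⊢
    exact (h i).1.trans_lt hi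
  have h2 : countBelow k x ≤ countBelow l x + 1 := by
    have hsub : (Finset.univ.filter fun i => k i < x) ⊆
        insert 0 ((Finset.univ.filter fun i => l i < x).image Fin.succ) := by
      intro j hj
      simp only [Finset.mem_filter, Finset.mem_univ, true_and, Finset.mem_insert,
        Finset.mem_image] at hj ⊢
      induction j using Fin.cases with
      | zero => exact Or.inl rfl
      | succ j => exact Or.inr ⟨j, (h j).2.trans_lt hj, rfl⟩
    exact (Finset.card_le_card hsub).trans
      ((Finset.card_insert_le _ _).trans (Nat.add_le_add_right Finset.card_image_le 1))
  omega

theorem interlacing_of_countBelow {n : ℕ} {k : Fin (n + 1) → ℤ} {l : Fin n → ℤ}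
    (hk : StrictMono k) (hl : StrictMono l) (hk0 : ∀ i, 0 ≤ k i) (hl0 : ∀ i, 0 ≤ l i)
    (h : ∀ t : ℕ, (countBelow k t : ℤ) - countBelow l t = 0 ∨
      (countBelow k t : ℤ) - countBelow l t = 1) : l ∈ interlacing k := by
  refine mem_interlacing.2 ⟨fun i => ⟨?_, ?_⟩, hl⟩
  · by_contra! hlt
    -- If l_i < k_i, then just above l_i the count for `l` exceeds that for `k`.
    have h1 := h (l i + 1).toNat
    rw [Int.toNat_of_nonneg (by linarith [hl0 i])] at h1
    have h2 := le_countBelow hl (lt_add_one (l i))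
    have h3 := countBelow_le hk (Int.add_one_le_iff.2 hlt)
    simp only [Fin.val_castSucc] at h3
    omega
  · by_contra! hlt
    -- If k_{i+1} < l_i, then just above k_{i+1} the count for `k` is at least i + 2 and that for
    -- `l` at most i.
    have h1 := h (k i.succ + 1).toNat
    rw [Int.toNat_of_nonneg (by linarith [hk0 i.succ])] at h1
    have h2 := le_countBelow hk (lt_add_one (k i.succ))
    have h3 := countBelow_le hl (Int.add_one_le_iff.2 hlt)
    simp only [Fin.val_succ] at h2
    omega

/-- A `0`-`1` sequence with sum `m` marks the values of an increasing sequence of length `m`. -/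
theorem exists_strictMono_valueCount {m N : ℕ} {x : Fin N → ℤ} (hx : ∀ c, x c = 0 ∨ x c = 1)
    (hs : ∑ c, x c = m) : ∃ l : Fin m → ℤ, StrictMono l ∧ (∀ i, 0 ≤ l i ∧ l i < N) ∧
      ∀ c : Fin N, x c = valueCount l ((c : ℕ) : ℤ) := by
  let C : Finset (Fin N) := Finset.univ.filter fun c => x c = 1
  have hC : C.card = m := by
    have : (C.card : ℤ) = m := by
      rw [← hs, Finset.card_filter, Nat.cast_sum]
      refine Finset.sum_congr rfl fun c _ => ?_
      rcases hx c with h | h <;> simp [h]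
    exact_mod_cast this
  have hmono : StrictMono fun i : Fin m => (((C.orderEmbOfFin hC i : Fin N) : ℕ) : ℤ) :=
    fun i j hij => Int.ofNat_lt.2 (Fin.lt_def.1 ((C.orderEmbOfFin hC).strictMono hij))
  refine ⟨_, hmono, fun i => ⟨by positivity, by simp⟩, fun c => ?_⟩
  by_cases hc : c ∈ C
  · have : c ∈ Set.range (C.orderEmbOfFin hC) := by simpa using hc
    obtain ⟨i, rfl⟩ := this
    rw [valueCount_eq_one hmono i]
    exact (Finset.mem_filter.1 hc).2
  · rw [valueCount_eq_zero]
    · rcases hx c with h | h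
      · exact h
      · exact absurd (Finset.mem_filter.2 ⟨Finset.mem_univ c, h⟩ : c ∈ C) hc
    · intro i hi
      have : C.orderEmbOfFin hC i = c := Fin.ext (by exact_mod_cast hi)
      exact hc (this ▸ C.orderEmbOfFin_mem hC i)

theorem eq_of_valueCount_eq {m N : ℕ} {l l' : Fin m → ℤ} (hl : StrictMono l)
    (hl' : StrictMono l') (hr : ∀ i, 0 ≤ l i ∧ l i < N) (hr' : ∀ i, 0 ≤ l' i ∧ l' i < N)
    (h : ∀ c : Fin N, valueCount l ((c : ℕ) : ℤ) = valueCount l' ((c : ℕ) : ℤ)) :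
    l = l' := by
  have key : ∀ {l l' : Fin m → ℤ}, StrictMono l → (∀ i, 0 ≤ l i ∧ l i < N) →
      (∀ c : Fin N, valueCount l ((c : ℕ) : ℤ) = valueCount l' ((c : ℕ) : ℤ)) →
      Set.range l ⊆ Set.range l' := by
    rintro l l' hl hr h _ ⟨i, rfl⟩
    by_contra hn
    have hi := hr i
    have := h ⟨(l i).toNat, by omega⟩
    simp only [Int.toNat_of_nonneg hi.1] at this
    rw [valueCount_eq_one hl, valueCount_eq_zero fun j hj => hn ⟨j, hj⟩] at this
    exact one_ne_zero this
  exact (hl.range_inj hl').1 ((key hl hr h).antisymm (key hl' hr' fun c => (h c).symm))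

/-! ### Partial alternating sign matrices -/

/-- The number of entries `-1` of a rectangular matrix. -/
def negOneEntries {m N : ℕ} (A : Matrix (Fin m) (Fin N) ℤ) : ℕ :=
  (Finset.univ.filter fun p : Fin m × Fin N => A p.1 p.2 = -1).card

theorem negOneEntries_eq_sum {m N : ℕ} (A : Matrix (Fin m) (Fin N) ℤ) :
    negOneEntries A = ∑ i, (Finset.univ.filter fun c => A i c = -1).card := by
  simp only [negOneEntries, Finset.card_filter, Fintype.sum_prod_type]

/-- The matrix without its last row. -/
def dropLastRow {m N : ℕ} (A : Matrix (Fin (m + 1)) (Fin N) ℤ) : Matrix (Fin m) (Fin N) ℤ :=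
  fun i => A i.castSucc

/-- The matrix with the row `r` added at the bottom. -/
def addLastRow {m N : ℕ} (A : Matrix (Fin m) (Fin N) ℤ) (r : Fin N → ℤ) :
    Matrix (Fin (m + 1)) (Fin N) ℤ :=
  Fin.snoc (α := fun _ => Fin N → ℤ) A r

theorem addLastRow_castSucc {m N : ℕ} (A : Matrix (Fin m) (Fin N) ℤ) (r : Fin N → ℤ) (i : Fin m) :
    addLastRow A r i.castSucc = A i :=
  Fin.snoc_castSucc (α := fun _ => Fin N → ℤ) r A i

theorem addLastRow_last {m N : ℕ} (A : Matrix (Fin m) (Fin N) ℤ) (r : Fin N → ℤ) :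
    addLastRow A r (Fin.last m) = r :=
  Fin.snoc_last (α := fun _ => Fin N → ℤ) r A

theorem dropLastRow_addLastRow {m N : ℕ} (A : Matrix (Fin m) (Fin N) ℤ) (r : Fin N → ℤ) :
    dropLastRow (addLastRow A r) = A :=
  funext fun i => addLastRow_castSucc A r i

theorem negOneEntries_succ {m N : ℕ} (A : Matrix (Fin (m + 1)) (Fin N) ℤ) :
    negOneEntries A = (Finset.univ.filter fun c => A (Fin.last m) c = -1).card +
      negOneEntries (dropLastRow A) := by
  rw [negOneEntries_eq_sum, negOneEntries_eq_sum, Fin.sum_univ_castSucc, add_comm]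
  rfl

/-- The first `m` rows of an alternating sign matrix, with the columns of sum `1` given by `k`. -/
structure IsPartialASM {m N : ℕ} (k : Fin m → ℤ) (A : Matrix (Fin m) (Fin N) ℤ) : Prop where
  row : ∀ i, HasUnitPrefixes (A i)
  col : ∀ c t, prefixSum (fun i => A i c) t = 0 ∨ prefixSum (fun i => A i c) t = 1
  col_sum : ∀ c : Fin N, ∑ i, A i c = valueCount k ((c : ℕ) : ℤ)

theorem prefixSum_dropLastRow {m N : ℕ} (A : Matrix (Fin (m + 1)) (Fin N) ℤ) (c : Fin N) (t : ℕ) :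
    prefixSum (fun i => dropLastRow A i c) t = prefixSum (fun i => A i c) (min t m) :=
  prefixSum_castLE (Nat.le_succ m) (fun i => A i c) t

theorem IsPartialASM.lastRow {m N : ℕ} {k : Fin (m + 1) → ℤ} {l : Fin m → ℤ}
    {A : Matrix (Fin (m + 1)) (Fin N) ℤ} (hA : IsPartialASM k A)
    (hl : ∀ c : Fin N, ∑ i, dropLastRow A i c = valueCount l ((c : ℕ) : ℤ)) :
    A (Fin.last m) = fun c : Fin N =>
      valueCount k ((c : ℕ) : ℤ) - valueCount l ((c : ℕ) : ℤ) := by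
  funext c
  rw [← hl c, ← hA.col_sum c, Fin.sum_univ_castSucc]
  simp [dropLastRow]

/-- The remaining column sums are column prefixes, hence 0 or 1, and mark a sequence `l`. The prefix
sums of the removed row are differences of counting functions, so its prefix condition says that `l`
interlaces `k`. -/
theorem IsPartialASM.exists_dropLastRow {m N : ℕ} {k : Fin (m + 1) → ℤ} (hk : StrictMono k)
    (hr : ∀ i, 0 ≤ k i ∧ k i < N) {A : Matrix (Fin (m + 1)) (Fin N) ℤ} (hA : IsPartialASM k A) :
    ∃ l ∈ interlacing k, IsPartialASM l (dropLastRow A) := by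
  have hcol : ∀ c t, prefixSum (fun i => dropLastRow A i c) t = 0 ∨
      prefixSum (fun i => dropLastRow A i c) t = 1 := by
    intro c t
    rw [prefixSum_dropLastRow]
    exact hA.col c _
  obtain ⟨l, hl, hlr, hlc⟩ := exists_strictMono_valueCount (m := m)
    (x := fun c => ∑ i, dropLastRow A i c)
    (fun c => by
      rw [← prefixSum_of_le (fun i => dropLastRow A i c) le_rfl]
      exact hcol c m)
    (by
      rw [Finset.sum_comm]
      simp [dropLastRow, (hA.row _).total])
  refine ⟨l, interlacing_of_countBelow hk hl (fun i => (hr i).1) (fun i => (hlr i).1) fun t => ?_,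
    fun i => hA.row _, hcol, hlc⟩
  rw [← prefixSum_valueCount hr, ← prefixSum_valueCount hlr, ← prefixSum_sub, ← hA.lastRow hlc]
  exact (hA.row _).prefixes t

theorem interlacing_bounds {m N : ℕ} {k : Fin (m + 1) → ℤ} (hr : ∀ i, 0 ≤ k i ∧ k i < N)
    {l : Fin m → ℤ} (hl : l ∈ interlacing k) (i : Fin m) : 0 ≤ l i ∧ l i < N := by
  have := (mem_interlacing.1 hl).1 i
  exact ⟨(hr _).1.trans this.1, this.2.trans_lt (hr _).2⟩

theorem IsPartialASM.addLastRow {m N : ℕ} {k : Fin (m + 1) → ℤ} (hk : StrictMono k)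
    (hr : ∀ i, 0 ≤ k i ∧ k i < N) {l : Fin m → ℤ} (hl : l ∈ interlacing k)
    {B : Matrix (Fin m) (Fin N) ℤ} (hB : IsPartialASM l B) :
    IsPartialASM k (addLastRow B fun c : Fin N =>
      valueCount k ((c : ℕ) : ℤ) - valueCount l ((c : ℕ) : ℤ)) := by
  have hlr := interlacing_bounds hr hl
  set r : Fin N → ℤ := fun c : Fin N => valueCount k ((c : ℕ) : ℤ) - valueCount l ((c : ℕ) : ℤ)
    with hrdef
  have hsum : ∀ c : Fin N, ∑ i, _root_.addLastRow B r i c = valueCount k ((c : ℕ) : ℤ) := by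
    intro c
    rw [Fin.sum_univ_castSucc, addLastRow_last]
    simp only [addLastRow_castSucc, hB.col_sum, r]
    ring
  have hpre : ∀ t, prefixSum r t = (countBelow k t : ℤ) - countBelow l t := by
    intro t
    rw [hrdef, prefixSum_sub, prefixSum_valueCount hr, prefixSum_valueCount hlr]
  refine ⟨fun i => ?_, fun c t => ?_, hsum⟩
  · induction i using Fin.lastCases with
    | cast i => rw [addLastRow_castSucc]; exact hB.row i
    | last =>
      rw [addLastRow_last]
      refine ⟨fun t => ?_, ?_⟩
      · rw [hpre]
        exact countBelow_of_interlacing (mem_interlacing.1 hl).1 t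
      · rw [← prefixSum_of_le r le_rfl, hpre, countBelow_eq_of_lt fun i => (hr i).2,
          countBelow_eq_of_lt fun i => (hlr i).2]
        push_cast
        ring
  · by_cases ht : t ≤ m
    · have := prefixSum_dropLastRow (_root_.addLastRow B r) c t
      rw [min_eq_left ht, dropLastRow_addLastRow] at this
      rw [← this]
      exact hB.col c t
    · rw [prefixSum_of_le _ (by omega), hsum]
      exact valueCount_eq_zero_or_one hk _

theorem dropLastRow_injOn {m N : ℕ} (k : Fin (m + 1) → ℤ) :
    Set.InjOn (dropLastRow (m := m) (N := N)) {A | IsPartialASM k A} := by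
  intro A hA B hB h
  have hrow : ∀ i : Fin m, A i.castSucc = B i.castSucc := fun i => congrFun h i
  funext i
  induction i using Fin.lastCases with
  | cast i => exact hrow i
  | last =>
    funext c
    have h1 := hA.col_sum c
    rw [← hB.col_sum c, Fin.sum_univ_castSucc, Fin.sum_univ_castSucc] at h1
    simpa [hrow] using h1

/-- An entry -1 marks a value of `l` missing from `k`. Under interlacing, l_i is missing from `k`
exactly when it differs from both k_i and k_{i+1}. -/
theorem card_lastRow_eq_strictCount {m N : ℕ} {k : Fin (m + 1) → ℤ} (hk : StrictMono k)
    (hr : ∀ i, 0 ≤ k i ∧ k i < N) {l : Fin m → ℤ} (hl : l ∈ interlacing k) :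
    (Finset.univ.filter fun c : Fin N =>
      valueCount k ((c : ℕ) : ℤ) - valueCount l ((c : ℕ) : ℤ) = -1).card = strictCount k l := by
  have hlr := interlacing_bounds hr hl
  obtain ⟨hint, hmono⟩ := mem_interlacing.1 hl
  have hcast : ∀ i, (((l i).toNat : ℕ) : ℤ) = l i := fun i => Int.toNat_of_nonneg (hlr i).1
  symm
  refine Finset.card_bij
    (fun i _ => (⟨(l i).toNat, by have := hlr i; omega⟩ : Fin N)) ?_ ?_ ?_
  · intro i hi
    simp only [Finset.mem_filter, Finset.mem_univ, true_and] at hi ⊢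
    rw [hcast, valueCount_eq_one hmono, valueCount_eq_zero, zero_sub]
    intro j hj
    -- A coincidence k_j = l_i would give i < j < i + 1.
    rw [← hj, hk.lt_iff_lt, hk.lt_iff_lt, Fin.lt_def, Fin.lt_def, Fin.val_castSucc,
      Fin.val_succ] at hi
    omega
  · intro i _ j _ hij
    simp only [Fin.mk.injEq] at hij
    exact hmono.injective (by rw [← hcast i, ← hcast j, hij])
  · intro c hc
    simp only [Finset.mem_filter, Finset.mem_univ, true_and] at hc
    have h1 := valueCount_eq_zero_or_one hk ((c : ℕ) : ℤ)
    have h2 := valueCount_eq_zero_or_one hmono ((c : ℕ) : ℤ)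
    have hk0 : valueCount k ((c : ℕ) : ℤ) = 0 := by omega
    have hl1 : valueCount l ((c : ℕ) : ℤ) = 1 := by omega
    obtain ⟨i, hi⟩ : ∃ i, l i = ((c : ℕ) : ℤ) := by
      by_contra! hne
      rw [valueCount_eq_zero hne] at hl1
      exact zero_ne_one hl1
    have hne : ∀ j, k j ≠ l i := by
      intro j hj
      rw [← hi, ← hj, valueCount_eq_one hk] at hk0
      exact one_ne_zero hk0
    refine ⟨i, Finset.mem_filter.2 ⟨Finset.mem_univ _, (hint i).1.lt_of_ne (hne _),
      (hint i).2.lt_of_ne (hne _).symm⟩, Fin.ext ?_⟩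
    simp only [hi, Int.toNat_natCast]

/-- Same fibration as for monotone triangles. The fibres are disjoint because the column sums
determine `l`. -/
theorem partialASM_finite_and_enum {m N : ℕ} (k : Fin m → ℤ) (hk : StrictMono k)
    (hr : ∀ i, 0 ≤ k i ∧ k i < N) :
    {A : Matrix (Fin m) (Fin N) ℤ | IsPartialASM k A}.Finite ∧
      ∑ᶠ A ∈ {A : Matrix (Fin m) (Fin N) ℤ | IsPartialASM k A}, (2 : ℚ) ^ negOneEntries A =
        triangleFormula k := by
  induction m with
  | zero =>
    have : {A : Matrix (Fin 0) (Fin N) ℤ | IsPartialASM k A} = {0} := by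
      ext A
      simp only [Set.mem_ofPred_eq, Set.mem_singleton_iff]
      refine ⟨fun _ => Subsingleton.elim _ _, fun _ => ⟨fun i => i.elim0, fun c t => Or.inl ?_,
        fun c => ?_⟩⟩
      · rw [prefixSum_of_le _ (Nat.zero_le t)]
        simp
      · simp [valueCount]
    rw [this]
    refine ⟨Set.finite_singleton _, ?_⟩
    rw [finsum_mem_singleton]
    simp [negOneEntries, triangleFormula, vandermondeProd]
  | succ m ih =>
    rw [← sum_interlacing_triangleFormula hk]
    have hmono : ∀ l ∈ interlacing k, StrictMono l := fun l hl => (mem_interlacing.1 hl).2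
    have := finsum_mem_eq_sum_of_bijOn_biUnion
      (S := {A : Matrix (Fin (m + 1)) (Fin N) ℤ | IsPartialASM k A}) (I := interlacing k)
      (T := fun l => {A : Matrix (Fin m) (Fin N) ℤ | IsPartialASM l A}) dropLastRow
      (fun l hl => (ih l (hmono l hl) (interlacing_bounds hr hl)).1)
      (fun l hl l' hl' hne => Set.disjoint_left.2 fun A h h' => hne
        (eq_of_valueCount_eq (hmono l hl) (hmono l' hl') (interlacing_bounds hr hl)
          (interlacing_bounds hr hl') fun c => by rw [← h.col_sum c, ← h'.col_sum c]))
      ⟨fun A hA => by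
          obtain ⟨l, hl, hA⟩ := IsPartialASM.exists_dropLastRow hk hr hA
          exact Set.mem_biUnion hl hA,
        dropLastRow_injOn k, fun B hB => by
          simp only [Set.mem_iUnion] at hB
          obtain ⟨l, hl, hB⟩ := hB
          exact ⟨_, IsPartialASM.addLastRow hk hr hl hB, dropLastRow_addLastRow _ _⟩⟩
      (f := fun A => 2 ^ negOneEntries A) (g := fun A => 2 ^ negOneEntries A)
      (c := fun l => 2 ^ strictCount k l)
      (fun l hl A hA hA' => by
        rw [negOneEntries_succ, IsPartialASM.lastRow hA hA'.col_sum,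
          card_lastRow_eq_strictCount hk hr hl, pow_add])
    refine ⟨this.1, this.2.trans (Finset.sum_congr rfl fun l hl => ?_)⟩
    rw [(ih l (hmono l hl) (interlacing_bounds hr hl)).2]

/-! ### Enumeration and refined enumeration of alternating sign matrices -/

theorem Set.Finite.natCast_finsum_two_pow {α : Type*} {S : Set α} (hS : S.Finite) (f : α → ℕ) :
    ((∑ᶠ a ∈ S, 2 ^ f a : ℕ) : ℚ) = ∑ᶠ a ∈ S, (2 : ℚ) ^ f a := by
  rw [finsum_mem_eq_finite_toFinset_sum _ hS, finsum_mem_eq_finite_toFinset_sum _ hS]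
  push_cast
  rfl

theorem strictMono_val (n : ℕ) : StrictMono fun i : Fin n => ((i : ℕ) : ℤ) :=
  fun _ _ h => Int.ofNat_lt.2 h

theorem val_bounds {n : ℕ} (i : Fin n) : (0 : ℤ) ≤ ((i : ℕ) : ℤ) ∧ ((i : ℕ) : ℤ) < (n : ℕ) :=
  ⟨by positivity, by simp⟩

theorem isASM_iff_isPartialASM {n : ℕ} {A : Matrix (Fin n) (Fin n) ℤ} :
    IsASM A ↔ IsPartialASM (fun i : Fin n => ((i : ℕ) : ℤ)) A := by
  have h1 : ∀ c : Fin n, valueCount (fun i : Fin n => ((i : ℕ) : ℤ)) ((c : ℕ) : ℤ) = 1 :=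
    fun c => valueCount_eq_one (strictMono_val n) c
  rw [isASM_iff]
  refine ⟨fun h => ⟨h.1, fun c => (h.2 c).prefixes, fun c => ?_⟩,
    fun h => ⟨h.row, fun c => ⟨h.col c, ?_⟩⟩⟩
  · rw [h1, (h.2 c).total]
  · rw [h.col_sum, h1]

theorem asm_finite_and_enum (n : ℕ) : {A : Matrix (Fin n) (Fin n) ℤ | IsASM A}.Finite ∧
    negOneEnum (2 : ℕ) {A : Matrix (Fin n) (Fin n) ℤ | IsASM A} = 2 ^ n.choose 2 := by
  have h := partialASM_finite_and_enum (N := n) _ (strictMono_val n) val_bounds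
  simp only [← isASM_iff_isPartialASM] at h
  refine ⟨h.1, ?_⟩
  have h2 := h.2
  rw [triangleFormula_val, ← h.1.natCast_finsum_two_pow] at h2
  exact_mod_cast h2

theorem HasUnitPrefixes.rev {n : ℕ} {v : Fin n → ℤ} (h : HasUnitPrefixes v) :
    HasUnitPrefixes fun i => v i.rev := by
  refine ⟨fun t => ?_, ?_⟩
  · rw [prefixSum_rev, h.total]
    have := h.prefixes (n - t)
    omega
  · rw [← h.total]
    exact Equiv.sum_comp Fin.revPerm v

/-- Reflection in the horizontal axis. -/
def flipRows {n : ℕ} (A : Matrix (Fin n) (Fin n) ℤ) : Matrix (Fin n) (Fin n) ℤ := fun i => A i.rev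

theorem flipRows_flipRows {n : ℕ} (A : Matrix (Fin n) (Fin n) ℤ) : flipRows (flipRows A) = A := by
  funext i
  simp [flipRows]

theorem IsASM.flipRows {n : ℕ} {A : Matrix (Fin n) (Fin n) ℤ} (h : IsASM A) :
    IsASM (flipRows A) := by
  rw [isASM_iff] at h ⊢
  exact ⟨fun i => h.1 i.rev, fun j => (h.2 j).rev⟩

theorem negOneEntries_flipRows {n : ℕ} (A : Matrix (Fin n) (Fin n) ℤ) :
    negOneEntries (flipRows A) = negOneEntries A := by
  rw [negOneEntries_eq_sum, negOneEntries_eq_sum]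
  exact Equiv.sum_comp Fin.revPerm fun i => (Finset.univ.filter fun c => A i c = -1).card

theorem strictMono_succAbove {m : ℕ} (p : Fin (m + 1)) :
    StrictMono fun i : Fin m => ((p.succAbove i : ℕ) : ℤ) :=
  fun _ _ h => Int.ofNat_lt.2 (Fin.strictMono_succAbove p h)

theorem succAbove_mem_interlacing {m : ℕ} (p : Fin (m + 1)) :
    (fun i : Fin m => ((p.succAbove i : ℕ) : ℤ)) ∈
      interlacing fun i : Fin (m + 1) => ((i : ℕ) : ℤ) := by
  refine mem_interlacing.2 ⟨fun i => ?_, strictMono_succAbove p⟩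
  simp only [Fin.succAbove]
  split_ifs <;> simp

theorem valueCount_succAbove {m : ℕ} (p c : Fin (m + 1)) :
    valueCount (fun i : Fin m => ((p.succAbove i : ℕ) : ℤ)) ((c : ℕ) : ℤ) =
      if c = p then 0 else 1 := by
  split_ifs with h
  · subst h
    exact valueCount_eq_zero fun i hi => c.succAbove_ne i (Fin.ext (by exact_mod_cast hi))
  · obtain ⟨i, rfl⟩ := Fin.exists_succAbove_eq h
    exact valueCount_eq_one (strictMono_succAbove p) i

/-- The last row of an alternating sign matrix has a single nonzero entry. -/
theorem IsASM.lastRow_eq {m : ℕ} {B : Matrix (Fin (m + 1)) (Fin (m + 1)) ℤ} (hB : IsASM B)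
    {p : Fin (m + 1)} (hp : B (Fin.last m) p = 1) (c : Fin (m + 1)) :
    B (Fin.last m) c = if c = p then 1 else 0 := by
  -- A last entry is the column total 1 minus a prefix sum in {0, 1}.
  have hnonneg : ∀ c, 0 ≤ B (Fin.last m) c := by
    intro c
    have hcol := (isASM_iff.1 hB).2 c
    have h1 := prefixSum_succ (fun i => B i c) (Fin.last m).isLt
    have h2 := prefixSum_of_le (fun i => B i c) (le_refl (m + 1))
    have h3 := hcol.prefixes m
    rw [hcol.total] at h2
    simp only [Fin.val_last] at h1
    rw [h2] at h1
    have h4 : B ⟨m, (Fin.last m).isLt⟩ c = B (Fin.last m) c := rfl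
    omega
  split_ifs with h
  · rw [h, hp]
  · have hs := hB.row_sum (Fin.last m)
    rw [← Finset.add_sum_erase _ _ (Finset.mem_univ p), hp] at hs
    have hz : ∑ c ∈ Finset.univ.erase p, B (Fin.last m) c = 0 := by linarith
    exact (Finset.sum_eq_zero_iff_of_nonneg fun c _ => hnonneg c).1 hz c
      (Finset.mem_erase.2 ⟨h, Finset.mem_univ c⟩)

theorem IsASM.isPartialASM_dropLastRow {m : ℕ} {B : Matrix (Fin (m + 1)) (Fin (m + 1)) ℤ}
    (hB : IsASM B) {p : Fin (m + 1)} (hp : B (Fin.last m) p = 1) :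
    IsPartialASM (fun i : Fin m => ((p.succAbove i : ℕ) : ℤ)) (dropLastRow B) := by
  refine ⟨fun i => (isASM_iff.1 hB).1 _, fun c t => ?_, fun c => ?_⟩
  · rw [prefixSum_dropLastRow]
    exact ((isASM_iff.1 hB).2 c).prefixes _
  · have h := hB.col_sum c
    rw [Fin.sum_univ_castSucc, hB.lastRow_eq hp] at h
    rw [valueCount_succAbove]
    simp only [dropLastRow]
    split_ifs at h ⊢ <;> linarith

/-- The recursion strips the last row while the refinement concerns the first; the reflection
exchanges them. A row with its only 1 in column `p` leaves column sums 1 everywhere except at `p`.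
-/
theorem bijOn_dropLastRow_flipRows {m : ℕ} (p : Fin (m + 1)) :
    Set.BijOn (fun A => dropLastRow (flipRows A))
      {A : Matrix (Fin (m + 1)) (Fin (m + 1)) ℤ | IsASM A ∧ A 0 p = 1}
      {A | IsPartialASM (fun i : Fin m => ((p.succAbove i : ℕ) : ℤ)) A} := by
  refine ⟨?_, ?_, ?_⟩
  · rintro A ⟨hA, hp⟩
    exact hA.flipRows.isPartialASM_dropLastRow (by simpa [flipRows] using hp)
  · rintro A ⟨hA, -⟩ A' ⟨hA', -⟩ h
    have := dropLastRow_injOn _ (isASM_iff_isPartialASM.1 hA.flipRows)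
      (isASM_iff_isPartialASM.1 hA'.flipRows) h
    rw [← flipRows_flipRows A, this, flipRows_flipRows]
  · intro B hB
    have hC := IsPartialASM.addLastRow (strictMono_val (m + 1)) val_bounds
      (succAbove_mem_interlacing p) hB
    refine ⟨flipRows _, ⟨(isASM_iff_isPartialASM.2 hC).flipRows, ?_⟩, ?_⟩
    · simp only [flipRows, Fin.rev_zero, addLastRow_last, valueCount_succAbove, if_true, sub_zero]
      exact valueCount_eq_one (strictMono_val (m + 1)) p
    · simp only [flipRows_flipRows, dropLastRow_addLastRow]

theorem refined_asm_enum {m : ℕ} (p : Fin (m + 1)) :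
    negOneEnum (2 : ℕ) {A : Matrix (Fin (m + 1)) (Fin (m + 1)) ℤ | IsASM A ∧ A 0 p = 1} =
      2 ^ m.choose 2 * m.choose p := by
  have h := partialASM_finite_and_enum (N := m + 1) _ (strictMono_succAbove p)
    (fun i => val_bounds (p.succAbove i))
  have hbij := bijOn_dropLastRow_flipRows p
  have hfin := hbij.finite_iff_finite.2 h.1
  have hsum : ∑ᶠ A ∈ {A : Matrix (Fin (m + 1)) (Fin (m + 1)) ℤ | IsASM A ∧ A 0 p = 1},
      (2 : ℚ) ^ negOneCount A = 2 ^ m.choose 2 * m.choose p := by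
    rw [← triangleFormula_succAbove, ← h.2]
    refine finsum_mem_eq_of_bijOn _ hbij ?_
    rintro A ⟨hA, hp⟩
    have hrow := hA.flipRows.lastRow_eq (p := p) (by simpa [flipRows] using hp)
    -- The stripped row has no entry -1, so the weight is unchanged.
    have hcard : (Finset.univ.filter fun c => flipRows A (Fin.last m) c = -1).card = 0 := by
      rw [Finset.card_eq_zero, Finset.filter_eq_empty_iff]
      intro c _
      rw [hrow]
      split_ifs <;> norm_num
    change (2 : ℚ) ^ negOneEntries A = _
    rw [← negOneEntries_flipRows, negOneEntries_succ, hcard, zero_add]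
  rw [← hfin.natCast_finsum_two_pow] at hsum
  exact_mod_cast hsum

/-! ### Vertically symmetric alternating sign matrices -/

/-- The first `m` columns of a matrix of size `2 * m + 1`, as rows. -/
def leftColumns {m : ℕ} (A : Matrix (Fin (2 * m + 1)) (Fin (2 * m + 1)) ℤ) :
    Matrix (Fin m) (Fin (2 * m + 1)) ℤ :=
  fun i c => A c (Fin.castLE (by omega) i)

/-- The vertically symmetric matrix with row sums `1` and the given left columns. -/
def symmetrize {m : ℕ} (B : Matrix (Fin m) (Fin (2 * m + 1)) ℤ) :
    Matrix (Fin (2 * m + 1)) (Fin (2 * m + 1)) ℤ :=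
  fun c j => if h : (j : ℕ) < m then B ⟨j, h⟩ c
    else if h' : (j.rev : ℕ) < m then B ⟨j.rev, h'⟩ c else 1 - 2 * ∑ i, B i c

theorem prefixSum_left {m : ℕ} (A : Matrix (Fin (2 * m + 1)) (Fin (2 * m + 1)) ℤ)
    (c : Fin (2 * m + 1)) (t : ℕ) :
    prefixSum (fun i => leftColumns A i c) t = prefixSum (A c) (min t m) :=
  prefixSum_castLE (by omega) (A c) t

theorem sum_leftColumns {m : ℕ} (A : Matrix (Fin (2 * m + 1)) (Fin (2 * m + 1)) ℤ)
    (c : Fin (2 * m + 1)) : ∑ i, leftColumns A i c = prefixSum (A c) m := by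
  rw [← prefixSum_of_le (fun i => leftColumns A i c) le_rfl, prefixSum_left, min_self]

theorem prefixSum_of_symm {n : ℕ} {v : Fin n → ℤ} (h : ∀ j, v j.rev = v j) (t : ℕ) :
    prefixSum v t = ∑ j, v j - prefixSum v (n - t) := by
  rw [← prefixSum_rev]
  simp only [h]

theorem sum_of_symm {m : ℕ} {v : Fin (2 * m + 1) → ℤ} (h : ∀ j, v j.rev = v j) :
    ∑ j, v j = 2 * prefixSum v m + v ⟨m, by omega⟩ := by
  have h1 := prefixSum_of_symm h m
  rw [show 2 * m + 1 - m = m + 1 by omega, prefixSum_succ v (by omega)] at h1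
  linarith

/-- The sequence `1, -1, 1, …` has alternating prefix sums. -/
theorem prefixSum_alternating {n : ℕ} {v : Fin n → ℤ} (h : ∀ c : Fin n, v c = 1 - 2 * ((c : ℕ) % 2))
    (t : ℕ) (ht : t ≤ n) : prefixSum v t = (t % 2 : ℕ) := by
  induction t with
  | zero => simp [prefixSum_zero]
  | succ t ih =>
    rw [prefixSum_succ v (by omega), ih (by omega), h]
    push_cast
    omega

theorem valueCount_odd {m : ℕ} (c : Fin (2 * m + 1)) :
    valueCount (fun i : Fin m => (2 * (i : ℕ) + 1 : ℤ)) ((c : ℕ) : ℤ) = ((c : ℕ) % 2 : ℕ) := by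
  have hmono : StrictMono fun i : Fin m => (2 * (i : ℕ) + 1 : ℤ) := fun i j h => by
    simp only
    rw [Fin.lt_def] at h
    omega
  rcases Nat.mod_two_eq_zero_or_one c with h | h
  · rw [h, Nat.cast_zero]
    refine valueCount_eq_zero fun i hi => ?_
    omega
  · have hc : ((c : ℕ) : ℤ) = 2 * (((c : ℕ) / 2 : ℕ) : ℤ) + 1 := by omega
    rw [h, Nat.cast_one, hc]
    exact valueCount_eq_one hmono ⟨(c : ℕ) / 2, by omega⟩

theorem IsVSASM.middle {m : ℕ} {A : Matrix (Fin (2 * m + 1)) (Fin (2 * m + 1)) ℤ}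
    (hA : IsVSASM A) (c : Fin (2 * m + 1)) :
    A c ⟨m, by omega⟩ = 1 - 2 * prefixSum (A c) m := by
  have := sum_of_symm (hA.symm c)
  rw [hA.isASM.row_sum] at this
  linarith

/-- Each left half row sum P is 0 or 1, so the middle entry 1 - 2P is never 0. The middle column
therefore has to be 1, -1, 1, …, which determines P by the parity of the row. -/
theorem IsVSASM.prefixSum_half {m : ℕ} {A : Matrix (Fin (2 * m + 1)) (Fin (2 * m + 1)) ℤ}
    (hA : IsVSASM A) (c : Fin (2 * m + 1)) : prefixSum (A c) m = ((c : ℕ) % 2 : ℕ) := by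
  obtain ⟨hrow, hcol⟩ := isASM_iff.1 hA.isASM
  have hmid := hcol ⟨m, by omega⟩
  have hstep : ∀ t (ht : t < 2 * m + 1),
      prefixSum (fun i => A i ⟨m, by omega⟩) (t + 1) =
        prefixSum (fun i => A i ⟨m, by omega⟩) t + 1 - 2 * prefixSum (A ⟨t, ht⟩) m := by
    intro t ht
    rw [prefixSum_succ _ ht, hA.middle]
    ring
  have halt : ∀ t ≤ 2 * m + 1,
      prefixSum (fun i => A i ⟨m, by omega⟩) t = (t % 2 : ℕ) := by
    intro t
    induction t with
    | zero => simp [prefixSum_zero]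
    | succ t ih =>
      intro ht
      have h1 := hstep t (by omega)
      have h2 := ih (by omega)
      have h3 := hmid.prefixes (t + 1)
      have h4 := (hrow ⟨t, by omega⟩).prefixes m
      omega
  have h1 := hstep c c.isLt
  rw [halt _ (by omega), halt _ (by omega), Fin.eta] at h1
  omega

theorem symmetrize_left {m : ℕ} (B : Matrix (Fin m) (Fin (2 * m + 1)) ℤ) :
    leftColumns (symmetrize B) = B := by
  funext i c
  simp [leftColumns, symmetrize]

theorem symmetrize_symm {m : ℕ} (B : Matrix (Fin m) (Fin (2 * m + 1)) ℤ)
    (c j : Fin (2 * m + 1)) : symmetrize B c j.rev = symmetrize B c j := by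
  have h := Fin.val_rev j
  simp only [symmetrize, Fin.rev_rev]
  split_ifs <;> first | rfl | omega

theorem symmetrize_middle {m : ℕ} (B : Matrix (Fin m) (Fin (2 * m + 1)) ℤ)
    (c : Fin (2 * m + 1)) : symmetrize B c ⟨m, by omega⟩ = 1 - 2 * ∑ i, B i c := by
  simp only [symmetrize]
  rw [dif_neg (by omega), dif_neg (by rw [Fin.val_rev]; simp only; omega)]

theorem IsPartialASM.symmetrize {m : ℕ} {B : Matrix (Fin m) (Fin (2 * m + 1)) ℤ}
    (hB : IsPartialASM (fun i : Fin m => (2 * (i : ℕ) + 1 : ℤ)) B) :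
    IsVSASM (symmetrize B) := by
  refine ⟨isASM_iff.2 ⟨fun c => ?_, fun j => ?_⟩, symmetrize_symm B⟩
  · have hleft : ∀ t ≤ m, prefixSum (_root_.symmetrize B c) t = prefixSum (fun i => B i c) t := by
      intro t ht
      have := prefixSum_left (_root_.symmetrize B) c t
      rw [symmetrize_left, min_eq_left ht] at this
      exact this.symm
    have htot : ∑ j, _root_.symmetrize B c j = 1 := by
      rw [sum_of_symm (symmetrize_symm B c), symmetrize_middle, hleft m le_rfl,
        prefixSum_of_le _ le_rfl]
      ring
    refine ⟨fun t => ?_, htot⟩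
    by_cases ht : t ≤ m
    · rw [hleft t ht]
      exact hB.col c t
    -- Past the middle, symmetry and total 1 give P(t) = 1 - P(2m + 1 - t), again 0 or 1.
    · rw [prefixSum_of_symm (symmetrize_symm B c), htot, hleft _ (by omega)]
      have := hB.col c (2 * m + 1 - t)
      omega
  · by_cases h : (j : ℕ) < m
    · have : (fun c => _root_.symmetrize B c j) = B ⟨j, h⟩ := by
        funext c
        simp [_root_.symmetrize, h]
      rw [this]
      exact hB.row _
    by_cases h' : (j.rev : ℕ) < m
    · have : (fun c => _root_.symmetrize B c j) = B ⟨j.rev, h'⟩ := by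
        funext c
        simp only [_root_.symmetrize, h, h', dif_pos, dif_neg, not_false_eq_true]
      rw [this]
      exact hB.row _
    have hm : m < 2 * m + 1 := by omega
    have hj : j = ⟨m, hm⟩ := by
      rw [Fin.val_rev] at h'
      exact Fin.ext (by simp only; omega)
    subst hj
    have hv : ∀ c : Fin (2 * m + 1),
        (fun c => _root_.symmetrize B c ⟨m, by omega⟩) c = 1 - 2 * ((c : ℕ) % 2) := by
      intro c
      simp only [symmetrize_middle, hB.col_sum, valueCount_odd]
      push_cast
      rfl
    have hpre := prefixSum_alternating hv
    have htot : ∑ c, _root_.symmetrize B c ⟨m, by omega⟩ = 1 := by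
      rw [← prefixSum_of_le (fun c => _root_.symmetrize B c ⟨m, by omega⟩) le_rfl,
        hpre _ le_rfl]
      omega
    refine ⟨fun t => ?_, htot⟩
    by_cases ht : t ≤ 2 * m + 1
    · rw [hpre t ht]
      omega
    · rw [prefixSum_of_le _ (by omega), htot]
      exact Or.inr rfl

/-- The left columns become the rows of a partial ASM, whose column sums are the half row sums 0, 1,
0, 1, …, 0; this is where the sequence 1, 3, …, 2m - 1 comes from. Symmetry and the row sums recover
the rest. -/
theorem bijOn_leftColumns (m : ℕ) :
    Set.BijOn leftColumns {A : Matrix (Fin (2 * m + 1)) (Fin (2 * m + 1)) ℤ | IsVSASM A}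
      {B | IsPartialASM (fun i : Fin m => (2 * (i : ℕ) + 1 : ℤ)) B} := by
  refine ⟨fun A hA => ?_, fun A hA A' hA' h => ?_, fun B hB => ?_⟩
  · have hA : IsVSASM A := hA
    obtain ⟨hrow, hcol⟩ := isASM_iff.1 hA.isASM
    refine ⟨fun i => hcol _, fun c t => ?_, fun c => ?_⟩
    · rw [prefixSum_left]
      exact (hrow c).prefixes _
    · rw [sum_leftColumns, hA.prefixSum_half, valueCount_odd]
  · have hA : IsVSASM A := hA
    have hA' : IsVSASM A' := hA'
    have hlt : ∀ c (j : Fin (2 * m + 1)), (j : ℕ) < m → A c j = A' c j := fun c j hj =>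
      congrFun (congrFun h ⟨j, hj⟩) c
    funext c j
    by_cases h1 : (j : ℕ) < m
    · exact hlt c j h1
    by_cases h2 : (j.rev : ℕ) < m
    · rw [← hA.symm, ← hA'.symm]
      exact hlt c _ h2
    have hj : j = ⟨m, by omega⟩ := by
      rw [Fin.val_rev] at h2
      exact Fin.ext (by simp only; omega)
    rw [hj, hA.middle, hA'.middle, ← sum_leftColumns, ← sum_leftColumns, h]
  · exact ⟨symmetrize B, IsPartialASM.symmetrize hB, symmetrize_left B⟩

theorem leftNegOneCount_eq {m : ℕ} (A : Matrix (Fin (2 * m + 1)) (Fin (2 * m + 1)) ℤ) :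
    leftNegOneCount A = negOneEntries (leftColumns A) := by
  rw [leftNegOneCount, negOneEntries]
  symm
  refine Finset.card_bij (fun p _ => (p.2, Fin.castLE (by omega) p.1)) ?_ ?_ ?_
  · rintro ⟨i, c⟩ hp
    simp only [Finset.mem_filter, Finset.mem_univ, true_and] at hp ⊢
    refine ⟨?_, hp⟩
    rw [Fin.lt_def, Fin.val_rev, Fin.val_castLE]
    omega
  · rintro ⟨i, c⟩ _ ⟨i', c'⟩ _ h
    simp only [Prod.mk.injEq, Fin.castLE_inj] at h
    rw [h.1, h.2]
  · rintro ⟨c, j⟩ hp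
    simp only [Finset.mem_filter, Finset.mem_univ, true_and] at hp
    have hj := hp.1
    rw [Fin.lt_def, Fin.val_rev] at hj
    exact ⟨(⟨j, by omega⟩, c), Finset.mem_filter.2 ⟨Finset.mem_univ _, hp.2⟩, rfl⟩

theorem vsasm_enum (m : ℕ) : vsasmEnum (2 : ℕ) (2 * m + 1) = 2 ^ (m * (m - 1)) := by
  have h := partialASM_finite_and_enum (N := 2 * m + 1)
    (fun i : Fin m => (2 * (i : ℕ) + 1 : ℤ))
    (fun i j hij => by
      simp only
      rw [Fin.lt_def] at hij
      omega)
    (fun i => by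
      have := i.isLt
      constructor <;> push_cast <;> omega)
  have hbij := bijOn_leftColumns m
  have hfin := hbij.finite_iff_finite.2 h.1
  have hsum : ∑ᶠ A ∈ {A : Matrix (Fin (2 * m + 1)) (Fin (2 * m + 1)) ℤ | IsVSASM A},
      (2 : ℚ) ^ leftNegOneCount A = 2 ^ (m * (m - 1)) := by
    rw [← triangleFormula_odd, ← h.2]
    refine finsum_mem_eq_of_bijOn _ hbij fun A _ => ?_
    rw [leftNegOneCount_eq]
  rw [← hfin.natCast_finsum_two_pow] at hsum
  exact_mod_cast hsum

theorem mainTheorem5 :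
    (∀ (n : ℕ) (k : Fin n → ℤ), StrictMono k →
      (monotoneTriangles n k).Finite ∧
      monotoneTriangleEnum (2 : ℚ) n k =
        2 ^ n.choose 2 *
          ∏ i : Fin n, ∏ j ∈ Finset.Ioi i,
            ((k j : ℚ) - (k i : ℚ)) / (((j : ℕ) : ℚ) - ((i : ℕ) : ℚ))) ∧
    (∀ n : ℕ, {A : Matrix (Fin n) (Fin n) ℤ | IsASM A}.Finite ∧
      negOneEnum (2 : ℕ) {A : Matrix (Fin n) (Fin n) ℤ | IsASM A} = 2 ^ n.choose 2) ∧
    (∀ (n l : ℕ) (hl : 1 ≤ l) (hln : l ≤ n),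
      negOneEnum (2 : ℕ) {A : Matrix (Fin n) (Fin n) ℤ |
          IsASM A ∧ A ⟨0, by omega⟩ ⟨l - 1, by omega⟩ = 1} =
        2 ^ (n - 1).choose 2 * (n - 1).choose (l - 1)) ∧
    (∀ n : ℕ, 1 ≤ n → vsasmEnum (2 : ℕ) (2 * n - 1) = 2 ^ ((n - 1) * (n - 2))) := by
  refine ⟨fun n k hk => ?_, asm_finite_and_enum, fun n l hl hln => ?_, fun n hn => ?_⟩
  · rw [← triangleFormula_eq_prod]
    exact monotoneTriangles_finite_and_enum n k hk
  · obtain ⟨m, rfl⟩ : ∃ m, n = m + 1 := ⟨n - 1, by omega⟩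
    exact refined_asm_enum ⟨l - 1, by omega⟩
  · obtain ⟨m, rfl⟩ : ∃ m, n = m + 1 := ⟨n - 1, by omega⟩
    exact vsasm_enum m
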